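/- **Setting.** Let $K \ge 1$ and let $L_1,\dots,L_K \ge 1$ be integers (the sizes of the components $C_1,\dots,C_K$ of a complete $K$-partite conflict graph). For each $j$ let $f_j:\mathbb R_+\to\mathbb R_+$ be non-decreasing with $f_j(\nu)\to\infty$ as $\nu\to\infty$. For every $\nu \ge 0$ let $\{X(t)\}_{t\ge 0}$ be the continuous-time Markov process (with right-continuous paths having left limits) on the finite state space $\Omega=\{0\}\cup\bigcup_{j=1}^K\mathcal B_j$, where $\mathcal B_j=\{(j,m):1\le m\le L_j\}$, with transition rates $$q(0,(j,1))=L_jf_j(\nu),\quad q((j,1),0)=1,\quad q((j,m),(j,m+1))=(L_j-m)f_j(\nu)\ (1\le m<L_j),\quad q((j,m),(j,m-1))=m\ (2\le m\le L_j),$$ all other rates being zero. Fix a state $(k,l)\in\mathcal B_k$ and suppose that $X(0)=(k,l)$ for every $\nu$. Let $$T=T_{(k,l),0}(\nu)=\inf\{t>0: X(t)=0\},\qquad \tau[0,t]=\int_0^t \mathbf 1\{X(s)=(k,L_k)\}\,ds$$ be the escape time from the branch $\mathcal B_k$ and the time spent during $[0,t]$ in the state in which all users of $C_k$ are active. **Proposition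 7.1.** Suppose that $T/\mathbb E T$ converges in distribution to a real random variable $Z$ as $\nu\to\infty$. Then $\mathbb E T<\infty$ for every $\nu$, and: 1. For every $\omega\in[0,1]$ and every $\delta>0$, $$\liminf_{\nu\to\infty}\ \mathbb P\big(\tau[0,\omega\,\mathbb E T]\ge(1-\delta)\,\omega\,\mathbb E T\big)\ \ge\ \mathbb P(Z\ge\omega).$$ 2. In particular, let $t(\nu)\ge 0$ satisfy $t(\nu)=o(\mathbb E T)$ as $\nu\to\infty$, and suppose that either $l=L_k$ or $f_k(\nu)\,t(\nu)\to\infty$ (if the process does not start at full activity, the time span must be long compared with the time $1/f_k(\nu)$ that it takes to activate a user). Then for every $\delta>0$, $$\liminf_{\nu\to\infty}\ \mathbb P\big(\tau[0,t(\nu)]\ge(1-\delta)\,t(\nu)\big)=1.$$ -/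

import Mathlib

open MeasureTheory Filter Topology Asymptotics
open scoped NNReal ENNReal

noncomputable section

/-- States of the activity process on a complete partite conflict graph whose components have
sizes `L 0, …, L (K - 1)`, aggregated by symmetry: `none` is the bottleneck state `0` (all users
inactive), and `some ⟨k, i⟩` is the state `(k, l)` with `l = i + 1` active users in component `k`.
Thus `i : Fin (L k)` encodes `l ∈ {1, …, L k}`. -/
abbrev ActivityState {K : ℕ} (L : Fin K → ℕ) : Type := Option (Σ k : Fin K, Fin (L k))

/-- The state `(k, L k)`, in which all users of component `k` are active. -/
def fullState {K : ℕ} (L : Fin K → ℕ) (hL : ∀ k, 0 < L k) (k : Fin K) : ActivityState L :=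
  some ⟨k, ⟨L k - 1, Nat.sub_lt (hL k) Nat.one_pos⟩⟩

/-- Transition rates of the activity process when users of component `k` activate at rate `a k`
and active users deactivate at rate `1`. With `l = i + 1` they read
`q(0, (k, 1)) = L k * a k`, `q((k, 1), 0) = 1`, `q((k, l), (k, l + 1)) = (L k - l) * a k`,
`q((k, l), (k, l - 1)) = l` for `l ≥ 2`, and all other rates vanish. -/
def activityRate {K : ℕ} (L : Fin K → ℕ) (a : Fin K → ℝ) :
    ActivityState L → ActivityState L → ℝ
  | none, none => 0
  | none, some ⟨k, i⟩ => if (i : ℕ) = 0 then (L k : ℝ) * a k else 0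
  | some ⟨_, i⟩, none => if (i : ℕ) = 0 then 1 else 0
  | some ⟨k, i⟩, some ⟨k', j⟩ =>
      if k = k' then
        if (j : ℕ) = (i : ℕ) + 1 then ((L k : ℝ) - ((i : ℝ) + 1)) * a k
        else if (i : ℕ) = (j : ℕ) + 1 then (i : ℝ) + 1
        else 0
      else 0

/-- The generator matrix with off-diagonal entries `q x y`, and row sums zero. -/
def generatorMatrix {S : Type*} [Fintype S] [DecidableEq S] (q : S → S → ℝ) : Matrix S S ℝ :=
  fun x y => if x = y then -∑ z ∈ Finset.univ.erase x, q x z else q x y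

/-- `X` is a continuous-time Markov process on the finite (discrete) state space `S`, with
generator matrix `Q`, started in `x₀`: its paths are right-continuous with left limits, and
`P(X (s + t) = y | X s = x, A) = exp(t Q) x y` for every event `A` that is determined by the
path up to time `s`. -/
structure IsMarkovProcess {S Ω : Type*} [Fintype S] [DecidableEq S] [MeasurableSpace Ω]
    (Q : Matrix S S ℝ) (x₀ : S) (P : Measure Ω) (X : ℝ≥0 → Ω → S) : Prop where
  measurable : ∀ (t : ℝ≥0) (x : S), MeasurableSet {ω | X t ω = x}
  right_continuous : ∀ (ω : Ω) (t : ℝ≥0), ∀ᶠ s in 𝓝[>] t, X s ω = X t ω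
  left_limit : ∀ (ω : Ω) (t : ℝ≥0), ∃ x : S, ∀ᶠ s in 𝓝[<] t, X s ω = x
  initial : ∀ᵐ ω ∂P, X 0 ω = x₀
  markov : ∀ (s t : ℝ≥0) (x y : S) (A : Set Ω),
    MeasurableSet[⨆ r ∈ Set.Iic s, MeasurableSpace.comap (X r) ⊤] A →
      P.real (A ∩ {ω | X s ω = x} ∩ {ω | X (s + t) ω = y}) =
        P.real (A ∩ {ω | X s ω = x}) * NormedSpace.exp ((t : ℝ) • Q) x y

/-- The hitting time `inf {t > 0 : X t = x}` along the path of `ω` (equal to `∞` if `x` is never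
hit). -/
def hittingTimeOf {S Ω : Type*} (X : ℝ≥0 → Ω → S) (x : S) (ω : Ω) : ℝ≥0∞ :=
  ⨅ (t : ℝ≥0) (_ : 0 < t ∧ X t ω = x), (t : ℝ≥0∞)

/-- The mean hitting time `E T` of `x`, as an extended real number. -/
def meanHittingTime {S Ω : Type*} [MeasurableSpace Ω] (P : Measure Ω) (X : ℝ≥0 → Ω → S)
    (x : S) : ℝ≥0∞ :=
  ∫⁻ ω, hittingTimeOf X x ω ∂P

open Classical in
/-- The time `∫₀ᵗ I{X s = x} ds` that the path of `ω` spends in `x` during `[0, t]`, `t ≥ 0`. -/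
def occupationTime {S Ω : Type*} (X : ℝ≥0 → Ω → S) (x : S) (t : ℝ) (ω : Ω) : ℝ :=
  ∫ s in (0 : ℝ)..t, if X s.toNNReal ω = x then 1 else 0

end

/-! Kill the process at the bottleneck state. Until the escape it never leaves branch `k`, where the
level is a birth-and-death chain with birth rates of order `a = f_k(ν)` and death rates at most `L =
L_k`. Two estimates, both instances of Dynkin's formula for the killed process, carry the proof.

(A) Away from full activity the chain is pushed up at rate at least `a`, so the mean time spent
there before `min(t, T)` is at most `(L - l) / a + L t / a`. Markov's inequality then bounds the
probability that no escape occurs by time `t` while the occupation time is below `(1 - δ) t`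
(`measure_avoids_occupationTime_lt_le`). The bound vanishes once `a → ∞`, and also `a t → ∞` unless
the chain starts at the top.

(B) The solution of the first-step equations for the mean escape time is almost the same at all
levels, since for large `a` the last step down from level 1 dominates. Hence `P(T ≤ t) ≤ L² / a + t
/ E T` (`measure_compl_avoids_le`).

The first claim combines (A) at a time slightly below `w E T` with the portmanteau theorem for an
open half-line; the second combines (A) and (B).

The processes are given only through their finite-dimensional Markov property. The link to Dynkin's
formula is `measureReal_avoids`: the law on the event of avoiding `z` is the exponential of the
killed generator. It comes from observing the path on dyadic grids and a product formula for `(e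
exp(Q / n) e) ^ n`. -/

/-! ### Products of compressed exponentials in a Banach algebra -/

/-- Telescoping. Applied with `M = 1 + O(1 / n)`, so that `M ^ n` stays bounded. -/
theorem norm_pow_sub_pow_le {A : Type*} [NormedRing A] [NormOneClass A] {a b : A} {M : ℝ}
    (hM : 1 ≤ M) (ha : ‖a‖ ≤ M) (hb : ‖b‖ ≤ M) (n : ℕ) :
    ‖a ^ n - b ^ n‖ ≤ n * M ^ n * ‖a - b‖ := by
  have hM0 : 0 ≤ M := zero_le_one.trans hM
  induction n with
  | zero => simp
  | succ n ih =>
    have h : a ^ (n + 1) - b ^ (n + 1) = a ^ n * (a - b) + (a ^ n - b ^ n) * b := by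
      rw [pow_succ, pow_succ]; noncomm_ring
    have h1 : ‖a ^ n‖ ≤ M ^ n :=
      (norm_pow_le a n).trans (pow_le_pow_left₀ (norm_nonneg _) ha n)
    have h2 : M ^ n ≤ M ^ (n + 1) := pow_le_pow_right₀ hM n.le_succ
    calc ‖a ^ (n + 1) - b ^ (n + 1)‖
        ≤ ‖a ^ n‖ * ‖a - b‖ + ‖a ^ n - b ^ n‖ * ‖b‖ := by
          rw [h]
          exact (norm_add_le _ _).trans (add_le_add (norm_mul_le _ _) (norm_mul_le _ _))
      _ ≤ M ^ (n + 1) * ‖a - b‖ + (n * M ^ n * ‖a - b‖) * M := by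
          gcongr
          exact h1.trans h2
      _ = ((n + 1 : ℕ) : ℝ) * M ^ (n + 1) * ‖a - b‖ := by push_cast; ring

/-- Two curves in a Banach algebra that agree to first order at `0` have asymptotically equal
`n`-th powers at `1 / n`. -/
theorem tendsto_pow_inv_sub_pow_inv {A : Type*} [NormedRing A] [NormOneClass A]
    [NormedAlgebra ℝ A] {F G : ℝ → A} {d : A} (hF : HasDerivAt F d 0) (hG : HasDerivAt G d 0)
    (h0 : F 0 = G 0) (h1 : ‖F 0‖ ≤ 1) :
    Tendsto (fun n : ℕ => F (n : ℝ)⁻¹ ^ n - G (n : ℝ)⁻¹ ^ n) atTop (𝓝 0) := by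
  have hinv : Tendsto (fun n : ℕ => (n : ℝ)⁻¹) atTop (𝓝 0) :=
    tendsto_inv_atTop_zero.comp tendsto_natCast_atTop_atTop
  have bound : ∀ H : ℝ → A, HasDerivAt H d 0 → ‖H 0‖ ≤ 1 →
      ∃ C, 0 ≤ C ∧ ∀ᶠ n : ℕ in atTop, ‖H (n : ℝ)⁻¹‖ ≤ 1 + C * (n : ℝ)⁻¹ := by
    intro H hH hH1
    obtain ⟨C, hC0, hC⟩ := hH.isBigO_sub.exists_nonneg
    refine ⟨C, hC0, ?_⟩
    filter_upwards [hinv.eventually hC.bound] with n hn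
    have h2 : ‖(n : ℝ)⁻¹ - 0‖ = (n : ℝ)⁻¹ := by rw [sub_zero, Real.norm_of_nonneg (by positivity)]
    rw [h2] at hn
    have h3 := norm_add_le (H 0) (H (n : ℝ)⁻¹ - H 0)
    rw [add_sub_cancel] at h3
    linarith
  obtain ⟨C, hC0, hC⟩ := bound F hF h1
  obtain ⟨D, hD0, hD⟩ := bound G hG (h0 ▸ h1)
  -- `F - G` vanishes at `0` together with its derivative, so it is `o(1 / n)` at `1 / n`; this
  -- beats the factor `n` from telescoping.
  have hlo : Tendsto (fun n : ℕ => Real.exp (C + D) * ((n : ℝ) * ‖F (n : ℝ)⁻¹ - G (n : ℝ)⁻¹‖))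
      atTop (𝓝 0) := by
    have h := ((hF.sub hG).isLittleO).comp_tendsto hinv
    have h' := h.norm_left.tendsto_div_nhds_zero
    rw [← mul_zero (Real.exp (C + D))]
    refine Tendsto.const_mul _ (h'.congr fun n => ?_)
    simp [h0, div_eq_mul_inv, mul_comm]
  refine squeeze_zero_norm' ?_ hlo
  filter_upwards [hC, hD, eventually_gt_atTop 0] with n hn1 hn2 hn
  have hn0 : (0 : ℝ) < n := by exact_mod_cast hn
  have hpos : 0 ≤ (n : ℝ)⁻¹ := by positivity
  have hp := norm_pow_sub_pow_le (M := 1 + (C + D) * (n : ℝ)⁻¹)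
    (by linarith [mul_nonneg hC0 hpos, mul_nonneg hD0 hpos])
    (hn1.trans (by linarith [mul_nonneg hD0 hpos]))
    (hn2.trans (by linarith [mul_nonneg hC0 hpos])) n
  have he : (1 + (C + D) * (n : ℝ)⁻¹) ^ n ≤ Real.exp (C + D) := by
    calc (1 + (C + D) * (n : ℝ)⁻¹) ^ n ≤ Real.exp ((C + D) * (n : ℝ)⁻¹) ^ n := by
          refine pow_le_pow_left₀ (by positivity) ?_ n
          linarith [Real.add_one_le_exp ((C + D) * (n : ℝ)⁻¹)]
      _ = Real.exp (C + D) := by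
          rw [← Real.exp_nat_mul]; congr 1; field_simp
  calc _ ≤ _ := hp
    _ = (1 + (C + D) * (n : ℝ)⁻¹) ^ n * (n * ‖F (n : ℝ)⁻¹ - G (n : ℝ)⁻¹‖) := by ring
    _ ≤ _ := by gcongr

/-- For an idempotent `e` of norm at most one, the powers `(e exp(a / n) e) ^ n` converge to
`e exp(e a e)`. -/
theorem tendsto_compressed_exp_pow {A : Type*} [NormedRing A] [NormOneClass A]
    [NormedAlgebra ℝ A] [CompleteSpace A] {e : A} (he : e * e = e) (h1 : ‖e‖ ≤ 1) (a : A) :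
    Tendsto (fun n : ℕ => (e * NormedSpace.exp ((n : ℝ)⁻¹ • a) * e) ^ n) atTop
      (𝓝 (e * NormedSpace.exp (e * a * e))) := by
  let _ : NormedAlgebra ℚ A := NormedAlgebra.restrictScalars ℚ ℝ A
  have hF : HasDerivAt (fun t : ℝ => e * NormedSpace.exp (t • a) * e) (e * a * e) 0 := by
    simpa using ((hasDerivAt_exp_smul_const a (0 : ℝ)).const_mul e).mul_const e
  have hG : HasDerivAt (fun t : ℝ => e * NormedSpace.exp (t • (e * a * e))) (e * a * e) 0 := by
    have h := (hasDerivAt_exp_smul_const (e * a * e) (0 : ℝ)).const_mul e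
    have h2 : e * (e * a * e) = e * a * e := by rw [← mul_assoc, ← mul_assoc, he]
    simpa [h2] using h
  have key := tendsto_pow_inv_sub_pow_inv hF hG (by simp [he]) (by simpa [he] using h1)
  -- Since `e` commutes with `e a e`, the `n`-th power of the comparison curve `G` at `1 / n` is
  -- exactly the limit, for every `n > 0`.
  have hcomm : Commute e (e * a * e) := by
    unfold Commute SemiconjBy
    rw [← mul_assoc, ← mul_assoc, he, mul_assoc (e * a), he]
  have hpow : ∀ n : ℕ, 0 < n → (e * NormedSpace.exp ((n : ℝ)⁻¹ • (e * a * e))) ^ n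
      = e * NormedSpace.exp (e * a * e) := by
    intro n hn
    have hc : Commute e (NormedSpace.exp ((n : ℝ)⁻¹ • (e * a * e))) :=
      (hcomm.smul_right _).exp_right
    have hen : e ^ n = e := by
      obtain ⟨m, rfl⟩ := Nat.exists_eq_succ_of_ne_zero hn.ne'
      exact IsIdempotentElem.pow_succ_eq m he
    rw [hc.mul_pow, hen, ← NormedSpace.exp_nsmul, ← Nat.cast_smul_eq_nsmul ℝ, smul_smul,
      mul_inv_cancel₀ (by exact_mod_cast hn.ne'), one_smul]
  have h3 := key.add_const (e * NormedSpace.exp (e * a * e))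
  rw [zero_add] at h3
  refine h3.congr' ?_
  filter_upwards [eventually_gt_atTop 0] with n hn
  rw [hpow n hn, sub_add_cancel]

/-! ### Taboo probabilities of a Markov process -/

/-- The generator of the process killed in state `z`. -/
def killedGenerator {S : Type*} [DecidableEq S] (Q : Matrix S S ℝ) (z : S) : Matrix S S ℝ :=
  fun x y => if x = z ∨ y = z then 0 else Q x y

/-- The projection onto the functions that vanish at `z`. -/
def killingProjection {S : Type*} [DecidableEq S] (z : S) : Matrix S S ℝ :=
  Matrix.diagonal fun x => if x = z then 0 else 1

section Matrix

variable {S : Type*} [Fintype S] [DecidableEq S]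

theorem killingProjection_mul_mul (Q : Matrix S S ℝ) (z x y : S) :
    (killingProjection z * Q * killingProjection z) x y =
      if x = z ∨ y = z then 0 else Q x y := by
  rw [killingProjection, Matrix.mul_diagonal, Matrix.diagonal_mul]
  by_cases hx : x = z <;> by_cases hy : y = z <;> simp [hx, hy]

attribute [local instance] Matrix.linftyOpNormedRing Matrix.linftyOpNormedAlgebra
  Matrix.linfty_opNormOneClass

theorem norm_killingProjection_le (z : S) : ‖killingProjection z‖ ≤ 1 := by
  rw [killingProjection, Matrix.linfty_opNorm_diagonal]
  refine (pi_norm_le_iff_of_nonneg zero_le_one).2 fun x => ?_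
  split_ifs <;> simp

/-- The left factor `e` of the limit only alters row `z`, so it disappears for `x ≠ z`. -/
theorem tendsto_killed_exp_pow (Q : Matrix S S ℝ) {x z : S} (hx : x ≠ z) (y : S) :
    Tendsto (fun n : ℕ =>
      ((killingProjection z * NormedSpace.exp ((n : ℝ)⁻¹ • Q) * killingProjection z) ^ n) x y)
      atTop (𝓝 (NormedSpace.exp (killedGenerator Q z) x y)) := by
  have : Nonempty S := ⟨x⟩
  have he : killingProjection z * killingProjection z = killingProjection z := by
    simp [killingProjection, Matrix.diagonal_mul_diagonal]
  have h := tendsto_compressed_exp_pow he (norm_killingProjection_le z) Q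
  have h2 : killingProjection z * Q * killingProjection z = killedGenerator Q z := by
    ext a b
    rw [killingProjection_mul_mul]
    rfl
  rw [h2] at h
  have h3 : (killingProjection z * NormedSpace.exp (killedGenerator Q z)) x y
      = NormedSpace.exp (killedGenerator Q z) x y := by
    rw [killingProjection, Matrix.diagonal_mul]
    simp [hx]
  rw [← h3]
  exact tendsto_pi_nhds.1 (tendsto_pi_nhds.1 h x) y

theorem hasDerivAt_exp_smul_mulVec (A : Matrix S S ℝ) (h : S → ℝ) (x : S) (t : ℝ) :
    HasDerivAt (fun s : ℝ => (NormedSpace.exp (s • A)).mulVec h x)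
      ((NormedSpace.exp (t • A)).mulVec (A.mulVec h) x) t := by
  have hd := hasDerivAt_exp_smul_const A t
  rw [Matrix.mulVec_mulVec]
  let φ : Matrix S S ℝ →ₗ[ℝ] ℝ :=
    { toFun := fun M => M.mulVec h x
      map_add' := fun M N => by rw [Matrix.add_mulVec]; rfl
      map_smul' := fun c M => by rw [Matrix.smul_mulVec]; rfl }
  exact (LinearMap.toContinuousLinearMap φ).hasFDerivAt.comp_hasDerivAt t hd

end Matrix

/-- The event that the path stays away from `z` up to time `t`. -/
def avoids {S Ω : Type*} (X : ℝ≥0 → Ω → S) (z : S) (t : ℝ≥0) : Set Ω :=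
  {ω | ∀ r ≤ t, X r ω ≠ z}

/-- Selects the first grid point strictly to the right of `s`, which is what right-continuity of the
paths can exploit. -/
theorem tendsto_floor_add_one_mul {c : ℕ → ℝ≥0} (hc : ∀ n, 0 < c n)
    (hc0 : Tendsto c atTop (𝓝 0)) (s : ℝ≥0) :
    Tendsto (fun n => ((⌊s / c n⌋₊ + 1 : ℕ) : ℝ≥0) * c n) atTop (𝓝[>] s) := by
  have h1 : ∀ n, s < ((⌊s / c n⌋₊ + 1 : ℕ) : ℝ≥0) * c n := fun n => by
    rw [← div_lt_iff₀ (hc n)]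
    exact_mod_cast Nat.lt_floor_add_one (s / c n)
  refine tendsto_nhdsWithin_iff.2 ⟨?_, Eventually.of_forall h1⟩
  refine tendsto_of_tendsto_of_tendsto_of_le_of_le tendsto_const_nhds
    (h := fun n => s + c n) (by simpa using hc0.const_add s) (fun n => (h1 n).le) fun n => ?_
  have h2 : (⌊s / c n⌋₊ : ℝ≥0) ≤ s / c n := Nat.floor_le (zero_le)
  have h3 := (le_div_iff₀ (hc n)).1 h2
  push_cast
  rw [add_mul, one_mul]
  gcongr

/-! ### Hitting times, measurability, and transition probabilities under avoidance. -/

section Paths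

variable {S Ω : Type*} {X : ℝ≥0 → Ω → S}

/-- Avoidance of a state is determined by avoidance on dyadic grids. -/
theorem avoids_eq_iInter
    (hr : ∀ ω t, ∀ᶠ s in 𝓝[>] t, X s ω = X t ω) (z : S) (t : ℝ≥0) :
    avoids X z t = ⋂ m : ℕ, {ω | ∀ i ≤ 2 ^ m, X ((i : ℕ) * (t / 2 ^ m)) ω ≠ z} := by
  ext ω
  simp only [avoids, Set.mem_ofPred_eq, Set.mem_iInter]
  constructor
  · intro h m i hi
    refine h _ ?_
    have : (i : ℝ≥0) ≤ 2 ^ m := by exact_mod_cast hi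
    calc (i : ℝ≥0) * (t / 2 ^ m) ≤ 2 ^ m * (t / 2 ^ m) := by gcongr
      _ = t := by field_simp
  · intro h r hrt hz
    rcases hrt.lt_or_eq with hlt | rfl
    · have ht : 0 < t := zero_le.trans_lt hlt
      have hc0 : Tendsto (fun m : ℕ => t / 2 ^ m) atTop (𝓝 0) := by
        have := (NNReal.tendsto_pow_atTop_nhds_zero_of_lt_one (r := (1 / 2 : ℝ≥0))
          (NNReal.half_lt_self one_ne_zero)).const_mul t
        simpa [div_eq_mul_inv] using this
      have hT := tendsto_floor_add_one_mul (c := fun m : ℕ => t / 2 ^ m)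
        (fun m => by positivity) hc0 r
      have hlt' : ∀ᶠ s in 𝓝[>] r, s < t := nhdsWithin_le_nhds (Iio_mem_nhds hlt)
      obtain ⟨m, hm1, hm2⟩ := ((hT.eventually (hr ω r)).and (hT.eventually hlt')).exists
      refine h m _ ?_ (hm1.trans hz)
      have hpos : 0 < t / 2 ^ m := by positivity
      have h2 : (2 : ℝ≥0) ^ m * (t / 2 ^ m) = t := by field_simp
      have h3 := hm2.trans_eq h2.symm
      have h4 := lt_of_mul_lt_mul_right h3 (zero_le)
      exact_mod_cast h4.le
    · refine h 0 1 le_rfl ?_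
      simpa using hz

/-- Right-continuity enters twice. A visit to `z` lasts beyond its start, so excluding time `0` from
the infimum does no harm; and absence from `z` at time `t` persists up to some `b > t`, which makes
the inequality strict. -/
theorem lt_hittingTimeOf_iff
    (hr : ∀ ω t, ∀ᶠ s in 𝓝[>] t, X s ω = X t ω) (z : S) (t : ℝ≥0) (ω : Ω) :
    (t : ℝ≥0∞) < hittingTimeOf X z ω ↔ ω ∈ avoids X z t := by
  constructor
  · intro h r hrt hz
    have hle : hittingTimeOf X z ω ≤ t := by
      rcases hrt.lt_or_eq with hlt | rfl
      · have hlt' : ∀ᶠ s in 𝓝[>] r, s < t := nhdsWithin_le_nhds (Iio_mem_nhds hlt)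
        obtain ⟨s, ⟨hs, hst⟩, hrs⟩ :=
          (((hr ω r).and hlt').and self_mem_nhdsWithin).exists
        refine (iInf₂_le s ⟨zero_le.trans_lt hrs, hs.trans hz⟩).trans ?_
        exact_mod_cast hst.le
      · refine ENNReal.le_of_forall_pos_le_add fun ε hε _ => ?_
        have hlt' : ∀ᶠ s in 𝓝[>] r, s < r + ε :=
          nhdsWithin_le_nhds (Iio_mem_nhds (lt_add_of_pos_right r hε))
        obtain ⟨s, ⟨hs, hst⟩, hrs⟩ :=
          (((hr ω r).and hlt').and self_mem_nhdsWithin).exists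
        refine (iInf₂_le s ⟨zero_le.trans_lt hrs, hs.trans hz⟩).trans ?_
        exact_mod_cast hst.le
    exact absurd h hle.not_gt
  · intro h
    have hev := hr ω t
    rw [(nhdsGT_basis t).eventually_iff] at hev
    obtain ⟨b, hb, hev⟩ := hev
    have hbT : (b : ℝ≥0∞) ≤ hittingTimeOf X z ω := by
      refine le_iInf₂ fun s hs => ?_
      by_contra! hlt
      have hsb : s < b := by exact_mod_cast hlt
      rcases le_or_gt s t with hst | hst
      · exact h s hst hs.2
      · exact h t le_rfl ((hev ⟨hst, hsb⟩).symm.trans hs.2)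
    exact lt_of_lt_of_le (by exact_mod_cast hb) hbT

variable [MeasurableSpace Ω]

theorem measurableSet_avoids (hm : ∀ t x, MeasurableSet {ω | X t ω = x})
    (hr : ∀ ω t, ∀ᶠ s in 𝓝[>] t, X s ω = X t ω) (z : S) (t : ℝ≥0) :
    MeasurableSet (avoids X z t) := by
  rw [avoids_eq_iInter hr]
  refine MeasurableSet.iInter fun m => ?_
  simp only [Set.ofPred_forall]
  exact MeasurableSet.iInter fun i => MeasurableSet.iInter fun _ => (hm _ z).compl

theorem measurable_hittingTimeOf (hm : ∀ t x, MeasurableSet {ω | X t ω = x})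
    (hr : ∀ ω t, ∀ᶠ s in 𝓝[>] t, X s ω = X t ω) (z : S) :
    Measurable (hittingTimeOf X z) := by
  refine measurable_of_Ioi fun a => ?_
  induction a with
  | top => simp
  | coe a =>
    have : hittingTimeOf X z ⁻¹' Set.Ioi (a : ℝ≥0∞) = avoids X z a :=
      Set.ext fun ω => lt_hittingTimeOf_iff hr z a ω
    rw [this]
    exact measurableSet_avoids hm hr z a

theorem measurableSet_setOf_eventually_atTop {α : Type*} [MeasurableSpace α] {p : ℕ → α → Prop}
    (hp : ∀ n, MeasurableSet {x | p n x}) : MeasurableSet {x | ∀ᶠ n in atTop, p n x} := by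
  simp only [eventually_atTop, Set.ofPred_exists, Set.ofPred_forall]
  exact MeasurableSet.iUnion fun _ => MeasurableSet.iInter fun n => MeasurableSet.iInter fun _ =>
    hp n

/-- By right-continuity the path value at `s` is the eventual value at the next grid point, and each
approximation is piecewise constant in time. Joint measurability is needed for Tonelli. -/
theorem measurableSet_uncurry_eq (hm : ∀ t x, MeasurableSet {ω | X t ω = x})
    (hr : ∀ ω t, ∀ᶠ s in 𝓝[>] t, X s ω = X t ω) (x : S) :
    MeasurableSet {p : ℝ≥0 × Ω | X p.1 p.2 = x} := by
  let c : ℕ → ℝ≥0 := fun n => 1 / ((n : ℝ≥0) + 1)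
  have hc : ∀ n, 0 < c n := fun n => by positivity
  have hc0 : Tendsto c atTop (𝓝 0) := tendsto_one_div_add_atTop_nhds_zero_nat
  have heq : {p : ℝ≥0 × Ω | X p.1 p.2 = x} =
      {p | ∀ᶠ n in atTop, X (((⌊p.1 / c n⌋₊ + 1 : ℕ) : ℝ≥0) * c n) p.2 = x} := by
    ext p
    have h := (tendsto_floor_add_one_mul hc hc0 p.1).eventually (hr p.2 p.1)
    constructor
    · intro hp
      filter_upwards [h] with n hn
      exact hn.trans hp
    · intro hp
      obtain ⟨n, hn1, hn2⟩ := (h.and hp).exists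
      exact hn1.symm.trans hn2
  rw [heq]
  refine measurableSet_setOf_eventually_atTop fun n => ?_
  have h2 : {p : ℝ≥0 × Ω | X (((⌊p.1 / c n⌋₊ + 1 : ℕ) : ℝ≥0) * c n) p.2 = x} =
      ⋃ j : ℕ, {s : ℝ≥0 | ⌊s / c n⌋₊ = j} ×ˢ {ω | X (((j + 1 : ℕ) : ℝ≥0) * c n) ω = x} := by
    ext p
    simp
  rw [h2]
  refine MeasurableSet.iUnion fun j => MeasurableSet.prod ?_ (hm _ x)
  have hmeas : Measurable fun s : ℝ≥0 => ⌊s / c n⌋₊ :=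
    Nat.measurable_floor.comp (measurable_id.div_const _)
  exact hmeas (measurableSet_singleton j)

theorem sum_measureReal_fibers [Fintype S] {P : Measure Ω} [IsFiniteMeasure P]
    (Y : Ω → S) (hY : ∀ x, MeasurableSet {ω | Y ω = x}) (B : Set Ω) :
    P.real B = ∑ x, P.real (B ∩ {ω | Y ω = x}) := by
  have h := sum_measureReal_preimage_singleton (μ := P.restrict B) Finset.univ
    (f := Y) (fun x _ => hY x)
  rw [Finset.coe_univ, Set.preimage_univ, measureReal_restrict_apply_univ] at h
  rw [← h]
  refine Finset.sum_congr rfl fun x _ => ?_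
  exact (measureReal_restrict_apply (hY x)).trans (by rw [Set.inter_comm])

variable [Fintype S] [DecidableEq S] {P : Measure Ω} [IsProbabilityMeasure P]

variable {Q : Matrix S S ℝ} {x₀ : S}

/-- Induction on `n`: condition on the position at time `n * h` and apply the Markov property there.
The projections discard the paths that are in `z` at a grid time. -/
theorem IsMarkovProcess.measureReal_grid (hX : IsMarkovProcess Q x₀ P X) {z : S} (h0 : x₀ ≠ z)
    (h : ℝ≥0) (n : ℕ) {y : S} (hy : y ≠ z) :
    P.real ({ω | ∀ i ≤ n, X ((i : ℕ) * h) ω ≠ z} ∩ {ω | X ((n : ℕ) * h) ω = y}) =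
      ((killingProjection z * NormedSpace.exp ((h : ℝ) • Q) * killingProjection z) ^ n) x₀ y := by
  induction n generalizing y with
  | zero =>
    have hae : ∀ᵐ ω ∂P, (ω ∈ {ω | ∀ i ≤ 0, X ((i : ℕ) * h) ω ≠ z} ∩ {ω | X ((0 : ℕ) * h) ω = y})
        ↔ x₀ = y := by
      filter_upwards [hX.initial] with ω hω
      simp [hω, h0]
    rw [pow_zero]
    by_cases hxy : x₀ = y
    · subst hxy
      rw [Matrix.one_apply_eq, ← probReal_univ (μ := P)]
      exact measureReal_congr (hae.mono fun ω hω => propext (hω.trans (iff_of_true rfl trivial)))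
    · rw [Matrix.one_apply_ne hxy, ← measureReal_empty (μ := P)]
      exact measureReal_congr (hae.mono fun ω hω => propext (hω.trans (iff_of_false hxy id)))
  | succ n ih =>
    rw [pow_succ, Matrix.mul_apply, sum_measureReal_fibers (X (n * h)) (hX.measurable _)]
    refine Finset.sum_congr rfl fun x _ => ?_
    rw [killingProjection_mul_mul]
    by_cases hx : x = z
    · rw [if_pos (Or.inl hx), mul_zero, ← measureReal_empty (μ := P)]
      congr 1
      refine Set.eq_empty_of_forall_notMem fun ω hω => ?_
      exact hω.1.1 n n.le_succ (hω.2.trans hx)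
    · rw [if_neg (by simp [hx, hy]), ← ih hx]
      have hmk := hX.markov (n * h) h x y {ω | ∀ i ≤ n, X ((i : ℕ) * h) ω ≠ z} ?_
      · rw [← hmk]
        congr 1
        ext ω
        have hs : ((n + 1 : ℕ) : ℝ≥0) * h = n * h + h := by push_cast; ring
        simp only [Set.mem_inter_iff, Set.mem_ofPred_eq, hs]
        constructor
        · rintro ⟨⟨h1, h2⟩, h3⟩
          exact ⟨⟨fun i hi => h1 i (hi.trans n.le_succ), h3⟩, h2⟩
        · rintro ⟨⟨h1, h2⟩, h3⟩
          refine ⟨⟨fun i hi => ?_, h3⟩, h2⟩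
          rcases Nat.le_succ_iff.1 hi with hi | rfl
          · exact h1 i hi
          · rw [hs, h3]; exact hy
      · simp only [Set.ofPred_forall]
        refine MeasurableSet.iInter fun i => MeasurableSet.iInter fun hi => ?_
        have hle : MeasurableSpace.comap (X (i * h)) ⊤ ≤
            ⨆ r ∈ Set.Iic ((n : ℝ≥0) * h), MeasurableSpace.comap (X r) ⊤ :=
          le_iSup₂_of_le (i * h) (by simp only [Set.mem_Iic]; gcongr) le_rfl
        exact hle _ ⟨{z}ᶜ, trivial, rfl⟩

/-- The grid events `G m` decrease to avoidance on `[0, t]`, while their probabilities are entries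
of the `2 ^ m`-th compressed power, which converge to the killed exponential. -/
theorem IsMarkovProcess.measureReal_avoids (hX : IsMarkovProcess Q x₀ P X) {z : S} (h0 : x₀ ≠ z)
    (t : ℝ≥0) {y : S} (hy : y ≠ z) :
    P.real (avoids X z t ∩ {ω | X t ω = y}) =
      NormedSpace.exp ((t : ℝ) • killedGenerator Q z) x₀ y := by
  let G : ℕ → Set Ω := fun m => {ω | ∀ i ≤ 2 ^ m, X ((i : ℕ) * (t / 2 ^ m)) ω ≠ z}
  have hG : Antitone G := by
    refine antitone_nat_of_succ_le fun m ω hω i hi => ?_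
    have := hω (2 * i) (by rw [pow_succ]; omega)
    have he : ((2 * i : ℕ) : ℝ≥0) * (t / 2 ^ (m + 1)) = i * (t / 2 ^ m) := by
      push_cast
      rw [pow_succ]
      field_simp
    rwa [he] at this
  have hGm : ∀ m, MeasurableSet (G m) := fun m => by
    simp only [G, Set.ofPred_forall]
    exact MeasurableSet.iInter fun i => MeasurableSet.iInter fun _ => (hX.measurable _ z).compl
  have hlim : Tendsto (fun m => P.real (G m ∩ {ω | X t ω = y})) atTop
      (𝓝 (P.real (avoids X z t ∩ {ω | X t ω = y}))) := by
    rw [avoids_eq_iInter hX.right_continuous, Set.iInter_inter]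
    refine (ENNReal.tendsto_toReal (measure_ne_top P _)).comp
      (tendsto_measure_iInter_atTop (fun m => ((hGm m).inter (hX.measurable t y)).nullMeasurableSet)
        (fun a b hab => Set.inter_subset_inter_left _ (hG hab)) ⟨0, measure_ne_top P _⟩)
  have hmat := (tendsto_killed_exp_pow ((t : ℝ) • Q) h0 y).comp
    (tendsto_pow_atTop_atTop_of_one_lt (one_lt_two : 1 < 2))
  have hk : killedGenerator ((t : ℝ) • Q) z = (t : ℝ) • killedGenerator Q z := by
    ext a b
    simp only [killedGenerator, Matrix.smul_apply]
    split_ifs <;> simp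
  rw [hk] at hmat
  refine tendsto_nhds_unique hlim (hmat.congr fun m => ?_)
  have h := hX.measureReal_grid h0 (t / 2 ^ m) (2 ^ m) hy
  have ht : ((2 ^ m : ℕ) : ℝ≥0) * (t / 2 ^ m) = t := by push_cast; field_simp
  rw [ht] at h
  have hc : ((2 ^ m : ℕ) : ℝ)⁻¹ * t = ((t / 2 ^ m : ℝ≥0) : ℝ) := by
    push_cast
    rw [div_eq_inv_mul]
  rw [h, Function.comp_apply, smul_smul, hc]

end Paths

/-! ### Dynkin's formula for the process killed in a state -/

noncomputable section

/-- The mean, started from `x`, of `h` at time `s` for the process with generator `Q` killed in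
state `z`. -/
def killedMean {S : Type*} [Fintype S] [DecidableEq S] (Q : Matrix S S ℝ) (z x : S) (h : S → ℝ)
    (s : ℝ) : ℝ :=
  (NormedSpace.exp (s • killedGenerator Q z)).mulVec h x

end

section Semigroup

variable {S : Type*} [Fintype S] [DecidableEq S] (Q : Matrix S S ℝ) (z x : S)

theorem hasDerivAt_killedMean (h : S → ℝ) (t : ℝ) :
    HasDerivAt (killedMean Q z x h)
      (killedMean Q z x ((killedGenerator Q z).mulVec h) t) t :=
  hasDerivAt_exp_smul_mulVec _ h x t

theorem continuous_killedMean (h : S → ℝ) : Continuous (killedMean Q z x h) :=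
  continuous_iff_continuousAt.2 fun t => (hasDerivAt_killedMean Q z x h t).continuousAt

theorem killedMean_zero (h : S → ℝ) : killedMean Q z x h 0 = h x := by
  simp [killedMean]

theorem killedMean_sub (h g : S → ℝ) (t : ℝ) :
    killedMean Q z x (h - g) t = killedMean Q z x h t - killedMean Q z x g t := by
  simp [killedMean, Matrix.mulVec_sub]

theorem killedMean_add (h g : S → ℝ) (t : ℝ) :
    killedMean Q z x (h + g) t = killedMean Q z x h t + killedMean Q z x g t := by
  simp [killedMean, Matrix.mulVec_add]

theorem killedMean_smul (c : ℝ) (h : S → ℝ) (t : ℝ) :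
    killedMean Q z x (c • h) t = c * killedMean Q z x h t := by
  simp [killedMean, Matrix.mulVec_smul]

theorem killedMean_sub_eq_integral (h : S → ℝ) (t : ℝ) :
    killedMean Q z x h t - h x =
      ∫ s in (0 : ℝ)..t, killedMean Q z x ((killedGenerator Q z).mulVec h) s := by
  rw [intervalIntegral.integral_eq_sub_of_hasDerivAt
    (fun s _ => hasDerivAt_killedMean Q z x h s)
    ((continuous_killedMean Q z x _).intervalIntegrable _ _), killedMean_zero]

/-- As `h` vanishes at `z`, deleting column `z` loses nothing; the rest is that the rows of the
generator sum to zero. -/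
theorem killedGenerator_generatorMatrix_mulVec (q : S → S → ℝ) {h : S → ℝ} (hz : h z = 0)
    {x : S} (hx : x ≠ z) :
    (killedGenerator (generatorMatrix q) z).mulVec h x = ∑ y, q x y * (h y - h x) := by
  have h1 : (killedGenerator (generatorMatrix q) z).mulVec h x =
      ∑ y, generatorMatrix q x y * h y := by
    refine Finset.sum_congr rfl fun y _ => ?_
    by_cases hy : y = z
    · simp [hy, hz]
    · simp [killedGenerator, hx, hy]
  rw [h1, ← Finset.add_sum_erase _ _ (Finset.mem_univ x),
    ← Finset.add_sum_erase (a := x) (f := fun y => q x y * (h y - h x)) _ (Finset.mem_univ x)]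
  have h2 : ∑ y ∈ Finset.univ.erase x, generatorMatrix q x y * h y =
      ∑ y ∈ Finset.univ.erase x, q x y * h y := by
    refine Finset.sum_congr rfl fun y hy => ?_
    rw [generatorMatrix, if_neg (Finset.ne_of_mem_erase hy).symm]
  rw [h2]
  simp only [generatorMatrix, if_true, sub_self, mul_zero, zero_add, mul_sub,
    Finset.sum_sub_distrib, neg_mul, Finset.sum_mul]
  ring

theorem killedGenerator_mulVec_self (Q : Matrix S S ℝ) (h : S → ℝ) :
    (killedGenerator Q z).mulVec h z = 0 := by
  simp [Matrix.mulVec, dotProduct, killedGenerator]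

end Semigroup

/-! ### Occupation times and hitting times expressed through the killed semigroup. -/

section KilledPaths

variable {S Ω : Type*} {X : ℝ≥0 → Ω → S} [MeasurableSpace Ω] [Fintype S] [DecidableEq S]
  {P : Measure Ω} {Q : Matrix S S ℝ} {x₀ z : S}

/-- The Lebesgue measure of the times in `(0, t]` that the path spends in `F` before hitting `z`. -/
noncomputable def timeBefore {S Ω : Type*} (X : ℝ≥0 → Ω → S) (z : S) (F : Set S) (t : ℝ)
    (ω : Ω) : ℝ≥0∞ :=
  volume {s : ℝ | (ω ∈ avoids X z s.toNNReal ∧ X s.toNNReal ω ∈ F) ∧ s ∈ Set.Ioc 0 t}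

theorem IsMarkovProcess.measurableSet_avoids_prod (hX : IsMarkovProcess Q x₀ P X) (z : S)
    (F : Set S) : MeasurableSet
      {p : Ω × ℝ | p.1 ∈ avoids X z p.2.toNNReal ∧ X p.2.toNNReal p.1 ∈ F} := by
  have hsw : Measurable fun p : Ω × ℝ => (p.2.toNNReal, p.1) := by fun_prop
  have h1 : MeasurableSet {p : Ω × ℝ | p.1 ∈ avoids X z p.2.toNNReal} := by
    have : {p : Ω × ℝ | p.1 ∈ avoids X z p.2.toNNReal} =
        {p | ((p.2.toNNReal : ℝ≥0) : ℝ≥0∞) < hittingTimeOf X z p.1} :=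
      Set.ext fun p => (lt_hittingTimeOf_iff hX.right_continuous z _ _).symm
    rw [this]
    exact measurableSet_lt (by fun_prop)
      ((measurable_hittingTimeOf hX.measurable hX.right_continuous z).comp measurable_fst)
  have h2 : {p : Ω × ℝ | X p.2.toNNReal p.1 ∈ F} =
      ⋃ x ∈ F, {p : Ω × ℝ | X p.2.toNNReal p.1 = x} := by
    ext p
    simp
  refine h1.inter ?_
  change MeasurableSet {p : Ω × ℝ | X p.2.toNNReal p.1 ∈ F}
  rw [h2]
  exact MeasurableSet.biUnion F.to_countable fun x _ =>
    hsw (measurableSet_uncurry_eq hX.measurable hX.right_continuous x)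

theorem IsMarkovProcess.timeBefore_eq (hX : IsMarkovProcess Q x₀ P X) (z : S) (F : Set S) (t : ℝ)
    (ω : Ω) : timeBefore X z F t ω = volume.restrict (Set.Ioc 0 t) (Prod.mk ω ⁻¹'
      {p : Ω × ℝ | p.1 ∈ avoids X z p.2.toNNReal ∧ X p.2.toNNReal p.1 ∈ F}) := by
  rw [Measure.restrict_apply (measurable_prodMk_left (hX.measurableSet_avoids_prod z F))]
  rfl

theorem IsMarkovProcess.measurable_timeBefore (hX : IsMarkovProcess Q x₀ P X) (z : S) (F : Set S)
    (t : ℝ) : Measurable (timeBefore X z F t) := by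
  rw [funext (hX.timeBefore_eq z F t)]
  exact measurable_measure_prodMk_left (hX.measurableSet_avoids_prod z F)

theorem IsMarkovProcess.measurableSet_times_eq (hX : IsMarkovProcess Q x₀ P X) (y : S) (ω : Ω) :
    MeasurableSet {s : ℝ | X s.toNNReal ω = y} := by
  have hsw : Measurable fun s : ℝ => (s.toNNReal, ω) := by fun_prop
  exact hsw (measurableSet_uncurry_eq hX.measurable hX.right_continuous y)

theorem IsMarkovProcess.occupationTime_eq (hX : IsMarkovProcess Q x₀ P X) (y : S)
    {t : ℝ} (ht : 0 ≤ t) (ω : Ω) : occupationTime X y t ω =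
      volume.real (Set.Ioc 0 t ∩ {s : ℝ | X s.toNNReal ω = y}) := by
  have hm := hX.measurableSet_times_eq y ω
  rw [occupationTime, intervalIntegral.integral_of_le ht]
  have h2 := integral_indicator_one (μ := volume.restrict (Set.Ioc 0 t)) hm
  rw [measureReal_restrict_apply hm, Set.inter_comm] at h2
  rw [← h2]
  refine integral_congr_ae (Eventually.of_forall fun s => ?_)
  simp [Set.indicator_apply]

theorem IsMarkovProcess.occupationTime_nonneg (hX : IsMarkovProcess Q x₀ P X) (y : S)
    {t : ℝ} (ht : 0 ≤ t) (ω : Ω) : 0 ≤ occupationTime X y t ω := by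
  rw [hX.occupationTime_eq y ht]
  exact measureReal_nonneg

theorem IsMarkovProcess.occupationTime_mono (hX : IsMarkovProcess Q x₀ P X) (y : S)
    {s t : ℝ} (hs : 0 ≤ s) (hst : s ≤ t) (ω : Ω) :
    occupationTime X y s ω ≤ occupationTime X y t ω := by
  rw [hX.occupationTime_eq y hs, hX.occupationTime_eq y (hs.trans hst)]
  refine measureReal_mono (Set.inter_subset_inter_left _ (Set.Ioc_subset_Ioc_right hst)) ?_
  exact ne_top_of_le_ne_top (by simp) (measure_mono Set.inter_subset_left)

/-- On the event that `z` has not been hit by time `t`, the occupation time of a state and the time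
spent in the other states add up to `t`. -/
theorem IsMarkovProcess.occupationTime_add_timeBefore (hX : IsMarkovProcess Q x₀ P X) (z y : S)
    {t : ℝ} (ht : 0 ≤ t) {ω : Ω} (hω : ω ∈ avoids X z t.toNNReal) :
    occupationTime X y t ω + (timeBefore X z {z, y}ᶜ t ω).toReal = t := by
  have hm := hX.measurableSet_times_eq y ω
  have h1 := hX.occupationTime_eq y ht ω
  have h3 : (timeBefore X z {z, y}ᶜ t ω).toReal =
      volume.real (Set.Ioc 0 t \ {s : ℝ | X s.toNNReal ω = y}) := by
    rw [timeBefore, Measure.real]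
    congr 2
    ext s
    constructor
    · rintro ⟨⟨_, h4⟩, h5⟩
      exact ⟨h5, fun h6 => h4 (Or.inr h6)⟩
    · rintro ⟨h5, h4⟩
      have h6 : s.toNNReal ≤ t.toNNReal := Real.toNNReal_le_toNNReal h5.2
      exact ⟨⟨fun r hr => hω r (hr.trans h6), not_or.2 ⟨hω _ h6, h4⟩⟩, h5⟩
  rw [h1, h3, measureReal_inter_add_sdiff hm (by simp)]
  simp [ht]

/-- Markov's inequality for the time that the path spends outside `y` before hitting `z`. -/
theorem IsMarkovProcess.measure_occupationTime_lt_le (hX : IsMarkovProcess Q x₀ P X) {y : S}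
    {C t δ : ℝ} (ht : 0 < t) (hδ : 0 < δ)
    (hC : ∫⁻ ω, timeBefore X z {z, y}ᶜ t ω ∂P ≤ ENNReal.ofReal C) :
    P {ω | ω ∈ avoids X z t.toNNReal ∧ occupationTime X y t ω < (1 - δ) * t} ≤
      ENNReal.ofReal (C / (δ * t)) := by
  have hδt : 0 < δ * t := mul_pos hδ ht
  have hsub : {ω | ω ∈ avoids X z t.toNNReal ∧ occupationTime X y t ω < (1 - δ) * t} ⊆
      {ω | ENNReal.ofReal (δ * t) ≤ timeBefore X z {z, y}ᶜ t ω} := by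
    rintro ω ⟨h1, h2⟩
    have h3 := hX.occupationTime_add_timeBefore z y ht.le h1
    refine ENNReal.ofReal_le_of_le_toReal ?_
    linarith
  calc _ ≤ _ := measure_mono hsub
    _ ≤ (∫⁻ ω, timeBefore X z {z, y}ᶜ t ω ∂P) / ENNReal.ofReal (δ * t) :=
      meas_ge_le_lintegral_div (hX.measurable_timeBefore z _ t).aemeasurable
        (by simpa using hδt) ENNReal.ofReal_ne_top
    _ ≤ ENNReal.ofReal C / ENNReal.ofReal (δ * t) := by gcongr
    _ = _ := (ENNReal.ofReal_div_of_pos hδt).symm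

variable [IsProbabilityMeasure P]

theorem IsMarkovProcess.killedMean_eq_sum (hX : IsMarkovProcess Q x₀ P X) (h0 : x₀ ≠ z)
    {h : S → ℝ} (hz : h z = 0) (t : ℝ≥0) :
    killedMean Q z x₀ h t = ∑ y, P.real (avoids X z t ∩ {ω | X t ω = y}) * h y := by
  refine Finset.sum_congr rfl fun y _ => ?_
  by_cases hy : y = z
  · simp [hy, hz]
  · rw [hX.measureReal_avoids h0 t hy]

theorem IsMarkovProcess.killedMean_mono (hX : IsMarkovProcess Q x₀ P X) (h0 : x₀ ≠ z)
    {h g : S → ℝ} (hz : h z = 0) (gz : g z = 0) (hg : ∀ y, h y ≤ g y) {t : ℝ} (ht : 0 ≤ t) :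
    killedMean Q z x₀ h t ≤ killedMean Q z x₀ g t := by
  lift t to ℝ≥0 using ht
  rw [hX.killedMean_eq_sum h0 hz, hX.killedMean_eq_sum h0 gz]
  exact Finset.sum_le_sum fun y _ => mul_le_mul_of_nonneg_left (hg y) measureReal_nonneg

theorem IsMarkovProcess.killedMean_nonneg (hX : IsMarkovProcess Q x₀ P X) (h0 : x₀ ≠ z)
    {h : S → ℝ} (hz : h z = 0) (hh : ∀ y, 0 ≤ h y) {t : ℝ} (ht : 0 ≤ t) :
    0 ≤ killedMean Q z x₀ h t := by
  lift t to ℝ≥0 using ht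
  rw [hX.killedMean_eq_sum h0 hz]
  exact Finset.sum_nonneg fun y _ => mul_nonneg measureReal_nonneg (hh y)

theorem IsMarkovProcess.killedMean_indicator (hX : IsMarkovProcess Q x₀ P X) (h0 : x₀ ≠ z)
    {F : Set S} (hF : z ∉ F) (t : ℝ≥0) :
    killedMean Q z x₀ (F.indicator 1) t = P.real (avoids X z t ∩ {ω | X t ω ∈ F}) := by
  classical
  rw [hX.killedMean_eq_sum h0 (by simp [hF]), sum_measureReal_fibers (X t) (hX.measurable t)]
  refine Finset.sum_congr rfl fun y _ => ?_
  by_cases hy : y ∈ F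
  · rw [Set.indicator_of_mem hy, Pi.one_apply, mul_one]
    congr 1
    ext ω
    simp only [Set.mem_inter_iff, Set.mem_ofPred_eq]
    constructor
    · rintro ⟨h1, h2⟩
      exact ⟨⟨h1, h2 ▸ hy⟩, h2⟩
    · rintro ⟨⟨h1, _⟩, h2⟩
      exact ⟨h1, h2⟩
  · rw [Set.indicator_of_notMem hy, mul_zero, ← measureReal_empty (μ := P)]
    congr 1
    symm
    refine Set.eq_empty_of_forall_notMem fun ω hω => hy ?_
    exact hω.2 ▸ hω.1.2

theorem IsMarkovProcess.killedMean_indicator_ne (hX : IsMarkovProcess Q x₀ P X) (h0 : x₀ ≠ z)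
    (t : ℝ≥0) : killedMean Q z x₀ (({z}ᶜ : Set S).indicator 1) t = P.real (avoids X z t) := by
  rw [hX.killedMean_indicator h0 (by simp)]
  congr 1
  exact Set.inter_eq_left.2 fun ω hω => hω t le_rfl

/-- Tonelli on the product of path space and time. -/
theorem IsMarkovProcess.lintegral_timeBefore (hX : IsMarkovProcess Q x₀ P X) (h0 : x₀ ≠ z)
    {F : Set S} (hF : z ∉ F) {t : ℝ} (ht : 0 ≤ t) :
    ∫⁻ ω, timeBefore X z F t ω ∂P =
      ENNReal.ofReal (∫ s in (0 : ℝ)..t, killedMean Q z x₀ (F.indicator 1) s) := by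
  have hW := hX.measurableSet_avoids_prod z F
  have h1 : ∫⁻ ω, timeBefore X z F t ω ∂P =
      (P.prod (volume.restrict (Set.Ioc 0 t)))
        {p : Ω × ℝ | p.1 ∈ avoids X z p.2.toNNReal ∧ X p.2.toNNReal p.1 ∈ F} := by
    rw [Measure.prod_apply hW]
    exact lintegral_congr fun ω => hX.timeBefore_eq z F t ω
  have hcont := continuous_killedMean Q z x₀ (F.indicator 1)
  rw [h1, Measure.prod_apply_symm hW, intervalIntegral.integral_of_le ht,
    ofReal_integral_eq_lintegral_ofReal]
  · refine setLIntegral_congr_fun measurableSet_Ioc fun s hs => ?_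
    have h2 := hX.killedMean_indicator h0 hF s.toNNReal
    rw [Real.coe_toNNReal s hs.1.le] at h2
    simp only [h2]
    exact (ofReal_measureReal).symm
  · exact (hcont.integrableOn_Icc).mono_set Set.Ioc_subset_Icc_self
  · refine (ae_restrict_iff' measurableSet_Ioc).2 (Eventually.of_forall fun s hs => ?_)
    exact hX.killedMean_nonneg h0 (by simp [hF])
      (fun y => Set.indicator_nonneg (fun _ _ => zero_le_one) y) hs.1.le

/-- The truncation `min T n` is at most the time spent off `z` before hitting it during `(0, n]`,
whose mean is controlled; monotone convergence removes the truncation without presupposing that `T`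
is finite. -/
theorem IsMarkovProcess.meanHittingTime_le (hX : IsMarkovProcess Q x₀ P X) (h0 : x₀ ≠ z)
    {C : ℝ} (hC : ∀ t, 0 ≤ t →
      ∫ s in (0 : ℝ)..t, killedMean Q z x₀ (({z}ᶜ : Set S).indicator 1) s ≤ C) :
    meanHittingTime P X z ≤ ENNReal.ofReal C := by
  have hT := measurable_hittingTimeOf hX.measurable hX.right_continuous z
  have hmin : ∀ n : ℕ, ∀ ω, min (hittingTimeOf X z ω) n ≤ timeBefore X z {z}ᶜ n ω := by
    intro n ω
    have hsub : ∀ r : ℝ≥0, (r : ℝ≥0∞) ≤ hittingTimeOf X z ω → (r : ℝ≥0∞) ≤ n →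
        (r : ℝ≥0∞) ≤ timeBefore X z {z}ᶜ n ω := by
      intro r hr hn
      have hrn : (r : ℝ) ≤ n := by
        have : r ≤ (n : ℝ≥0) := by exact_mod_cast hn
        exact_mod_cast this
      calc (r : ℝ≥0∞) = volume (Set.Ioo (0 : ℝ) r) := by simp
        _ ≤ timeBefore X z {z}ᶜ n ω := by
          refine measure_mono fun s hs => ?_
          have hav : ω ∈ avoids X z s.toNNReal := by
            refine (lt_hittingTimeOf_iff hX.right_continuous z _ ω).1 (lt_of_lt_of_le ?_ hr)
            rw [ENNReal.coe_lt_coe, ← NNReal.coe_lt_coe, Real.coe_toNNReal s hs.1.le]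
            exact hs.2
          exact ⟨⟨hav, hav _ le_rfl⟩, hs.1, hs.2.le.trans hrn⟩
    have hne : min (hittingTimeOf X z ω) n ≠ ∞ := by simp
    have := hsub (min (hittingTimeOf X z ω) n).toNNReal
    rw [ENNReal.coe_toNNReal hne] at this
    exact this (min_le_left _ _) (min_le_right _ _)
  have hsup : meanHittingTime P X z = ⨆ n : ℕ, ∫⁻ ω, min (hittingTimeOf X z ω) n ∂P := by
    rw [← lintegral_iSup (fun n => hT.min measurable_const)]
    · refine lintegral_congr fun ω => ?_
      rw [← inf_iSup_eq, ENNReal.iSup_natCast, inf_top_eq]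
    · intro m n hmn ω
      exact min_le_min_left _ (by exact_mod_cast hmn)
  rw [hsup]
  refine iSup_le fun n => (lintegral_mono (hmin n)).trans ?_
  rw [hX.lintegral_timeBefore h0 (by simp) n.cast_nonneg]
  exact ENNReal.ofReal_le_ofReal (hC n n.cast_nonneg)

end KilledPaths

/-! ### The activity process within one branch -/

noncomputable section

/-- The generator of the activity process with activation rates `a`. -/
abbrev activityGenerator {K : ℕ} (L : Fin K → ℕ) (a : Fin K → ℝ) :
    Matrix (ActivityState L) (ActivityState L) ℝ :=
  generatorMatrix (activityRate L a)

/-- The function on the state space that depends only on the level within branch `k`, and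
vanishes outside this branch. -/
def levelFunction {K : ℕ} (L : Fin K → ℕ) (k : Fin K) (H : ℕ → ℝ) : ActivityState L → ℝ
  | none => 0
  | some ⟨j, i⟩ => if j = k then H (i + 1) else 0

/-- The mean time to get from level `L - j` to level `L - j - 1`, for component size `L` and
activation rate `a`. -/
def descentTime (L : ℕ) (a : ℝ) : ℕ → ℝ
  | 0 => 1 / L
  | j + 1 => (1 + (j + 1) * a * descentTime L a j) / (L - (j + 1))

/-- The mean time to get from level `m` to level `0`. -/
def escapeTime (L : ℕ) (a : ℝ) (m : ℕ) : ℝ :=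
  ∑ i ∈ Finset.range m, descentTime L a (L - (i + 1))

end

/-! ### First-step equations and growth of the mean escape times. -/

theorem descentTime_pos {L : ℕ} {a : ℝ} (ha : 0 ≤ a) {j : ℕ} (hj : j < L) :
    0 < descentTime L a j := by
  induction j with
  | zero =>
    have : (0 : ℝ) < L := by exact_mod_cast hj
    rw [descentTime]
    positivity
  | succ j ih =>
    have h1 := ih (by omega)
    have h2 : (0 : ℝ) < L - (j + 1) := by
      rw [sub_pos]
      exact_mod_cast hj
    rw [descentTime]
    positivity

/-- First-step equation at level `m`: a jump up, at rate `(L - m) * a`, costs an extra descent from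
level `m + 1`. For `m = L` the index `L - (m + 1)` truncates to `0`, but its coefficient is zero. -/
theorem mul_descentTime {L m : ℕ} (a : ℝ) (h0 : 0 < m) (hm : m ≤ L) :
    m * descentTime L a (L - m) = 1 + (L - m) * a * descentTime L a (L - (m + 1)) := by
  rcases hm.lt_or_eq with hlt | rfl
  · obtain ⟨j, rfl⟩ : ∃ j, L = m + j + 1 := ⟨L - m - 1, by omega⟩
    have h1 : m + j + 1 - m = j + 1 := by omega
    have h2 : m + j + 1 - (m + 1) = j := by omega
    have h3 : ((m + j + 1 : ℕ) : ℝ) - (j + 1) = m := by push_cast; ring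
    have h4 : (m : ℝ) ≠ 0 := by exact_mod_cast h0.ne'
    rw [h1, h2, descentTime, h3]
    field_simp
    push_cast
    ring
  · have h4 : (m : ℝ) ≠ 0 := by exact_mod_cast h0.ne'
    simp [descentTime, h4]

theorem escapeTime_succ (L : ℕ) (a : ℝ) (m : ℕ) :
    escapeTime L a (m + 1) = escapeTime L a m + descentTime L a (L - (m + 1)) :=
  Finset.sum_range_succ _ _

theorem escapeTime_mono {L : ℕ} {a : ℝ} (ha : 0 ≤ a) (hL : 0 < L) : Monotone (escapeTime L a) :=
  monotone_nat_of_le_succ fun m => by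
    rw [escapeTime_succ]
    linarith [descentTime_pos ha (j := L - (m + 1)) (L := L) (by omega)]

theorem escapeTime_pos {L : ℕ} {a : ℝ} (ha : 0 ≤ a) (hL : 0 < L) {m : ℕ} (hm : 0 < m) :
    0 < escapeTime L a m := by
  refine lt_of_lt_of_le ?_ (escapeTime_mono ha hL hm)
  simp only [escapeTime, zero_add, Finset.range_one, Finset.sum_singleton]
  exact descentTime_pos ha (by omega)

/-- For high activation rates, it takes most of the time to get from level `1` to level `0`. -/
theorem escapeTime_top_le {L : ℕ} {a : ℝ} (hL : 0 < L) (ha : (L : ℝ) ≤ a) {m : ℕ} (hm : 0 < m) :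
    escapeTime L a L ≤ (1 + (L : ℝ) ^ 2 / a) * escapeTime L a m := by
  have hL0 : (0 : ℝ) < L := by exact_mod_cast hL
  have ha0 : 0 < a := hL0.trans_le ha
  -- With `d i` the descent time from level `i`, the first-step equation and `L - i ≥ 1` give `a * d
  -- (i + 1) ≤ i * d i ≤ L * d i`.
  have hstep : ∀ i, 0 < i → i < L →
      descentTime L a (L - (i + 1)) ≤ L / a * descentTime L a (L - i) := by
    intro i hi hiL
    have h1 := mul_descentTime a hi hiL.le
    have h2 : (1 : ℝ) ≤ L - i := by
      have : (i : ℝ) + 1 ≤ L := by exact_mod_cast hiL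
      linarith
    have h3 := descentTime_pos ha0.le (j := L - (i + 1)) (L := L) (by omega)
    have h4 := descentTime_pos ha0.le (j := L - i) (L := L) (by omega)
    have h5 : (i : ℝ) ≤ L := by exact_mod_cast hiL.le
    rw [div_mul_eq_mul_div, le_div_iff₀ ha0]
    have h6 : a * descentTime L a (L - (i + 1)) ≤ (L - i) * a * descentTime L a (L - (i + 1)) := by
      rw [mul_assoc]
      exact le_mul_of_one_le_left (mul_pos ha0 h3).le h2
    have h7 : (i : ℝ) * descentTime L a (L - i) ≤ L * descentTime L a (L - i) := by gcongr
    linarith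
  -- Iterating would give powers of `L / a`; since `L / a ≤ 1`, one factor is kept. Summing over
  -- fewer than `L` levels yields the constant `L ^ 2 / a`.
  have hall : ∀ i, 0 < i → i < L →
      descentTime L a (L - (i + 1)) ≤ L / a * descentTime L a (L - 1) := by
    intro i hi
    induction i, hi using Nat.le_induction with
    | base => exact hstep 1 one_pos
    | succ i hi ih =>
      intro hiL
      have h1 := ih (by omega)
      have h2 := hstep (i + 1) (by omega) hiL
      have h3 := descentTime_pos ha0.le (j := L - 1) (L := L) (by omega)
      have h4 : (L : ℝ) / a ≤ 1 := (div_le_one ha0).2 ha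
      have h5 : (L : ℝ) / a * descentTime L a (L - (i + 1)) ≤
          L / a * (L / a * descentTime L a (L - 1)) := by gcongr
      have h6 : (L : ℝ) / a * descentTime L a (L - 1) ≤ descentTime L a (L - 1) :=
        mul_le_of_le_one_left h3.le h4
      have h7 : (L : ℝ) / a * (L / a * descentTime L a (L - 1)) ≤
          L / a * descentTime L a (L - 1) := by gcongr
      linarith
  have h1 : escapeTime L a 1 = descentTime L a (L - 1) := by simp [escapeTime]
  have htop : escapeTime L a L ≤ (1 + (L : ℝ) ^ 2 / a) * escapeTime L a 1 := by
    obtain ⟨n, hn⟩ : ∃ n, L = n + 1 := ⟨L - 1, by omega⟩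
    have h2 : escapeTime L a L =
        ∑ i ∈ Finset.range n, descentTime L a (L - (i + 1 + 1)) + descentTime L a (L - 1) := by
      rw [escapeTime, show Finset.range L = Finset.range (n + 1) by rw [hn],
        Finset.sum_range_succ']
    have h3 : ∑ i ∈ Finset.range n, descentTime L a (L - (i + 1 + 1)) ≤
        ∑ _i ∈ Finset.range n, L / a * descentTime L a (L - 1) :=
      Finset.sum_le_sum fun i hi => hall (i + 1) (by omega) (by
        have := Finset.mem_range.1 hi
        omega)
    rw [Finset.sum_const, Finset.card_range, nsmul_eq_mul] at h3
    have h4 : (n : ℝ) ≤ L := by rw [hn]; push_cast; linarith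
    have h5 := descentTime_pos ha0.le (j := L - 1) (L := L) (by omega)
    have h6 : (n : ℝ) * (L / a * descentTime L a (L - 1)) ≤
        L * (L / a * descentTime L a (L - 1)) := by gcongr
    rw [h1, h2]
    calc _ ≤ L * (L / a * descentTime L a (L - 1)) + descentTime L a (L - 1) := by linarith
      _ = _ := by ring
  refine htop.trans ?_
  gcongr
  exact escapeTime_mono ha0.le hL hm

/-! ### The killed generator on functions of the level and on the other branches. -/

section Generator

variable {K : ℕ} {L : Fin K → ℕ} {a : Fin K → ℝ} {k : Fin K}

/-- The killed generator acts on functions of the level like a birth-and-death generator. -/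
theorem killedGenerator_mulVec_levelFunction {H : ℕ → ℝ} (hH : H 0 = 0) (i : Fin (L k)) :
    (killedGenerator (activityGenerator L a) none).mulVec (levelFunction L k H)
      (some ⟨k, i⟩) =
    (i + 1) * (H i - H (i + 1)) + (L k - (i + 1)) * a k * (H (i + 2) - H (i + 1)) := by
  rw [killedGenerator_generatorMatrix_mulVec none _
    (show levelFunction L k H none = 0 from rfl) (by simp),
    Fintype.sum_option, Fintype.sum_sigma, Finset.sum_eq_single k]
  · simp only [activityRate, levelFunction, if_true]
    rw [Fin.sum_univ_eq_sum_range (fun m : ℕ => (if m = i + 1 then ((L k : ℝ) - (i + 1)) * a k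
      else if (i : ℕ) = m + 1 then (i : ℝ) + 1 else 0) * (H (m + 1) - H (i + 1))) (L k)]
    have hsplit : ∀ m : ℕ, (if m = i + 1 then ((L k : ℝ) - (i + 1)) * a k
        else if (i : ℕ) = m + 1 then (i : ℝ) + 1 else 0) * (H (m + 1) - H (i + 1)) =
        (if m = i + 1 then ((L k : ℝ) - (i + 1)) * a k * (H (i + 2) - H (i + 1)) else 0) +
        (if (i : ℕ) = m + 1 then ((i : ℝ) + 1) * (H i - H (i + 1)) else 0) := by
      intro m
      by_cases h1 : m = i + 1
      · have h2 : ¬ (i : ℕ) = m + 1 := by omega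
        rw [if_pos h1, if_pos h1, if_neg h2, h1, add_zero]
      · by_cases h2 : (i : ℕ) = m + 1
        · rw [if_neg h1, if_pos h2, if_neg h1, if_pos h2, ← h2, zero_add]
        · simp [if_neg h1, if_neg h2]
    have hi := i.isLt
    have hup : ∑ m ∈ Finset.range (L k), (if m = i + 1 then
        ((L k : ℝ) - (i + 1)) * a k * (H (i + 2) - H (i + 1)) else 0) =
        ((L k : ℝ) - (i + 1)) * a k * (H (i + 2) - H (i + 1)) := by
      rw [Finset.sum_ite_eq']
      -- At the top level there is no state above, and the corresponding rate `L k - (i + 1)` is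
      -- zero, so the value `H (i + 2)` is irrelevant.
      split_ifs with h1
      · rfl
      · have h2 : (i : ℕ) + 1 = L k := by
          rw [Finset.mem_range] at h1
          omega
        have h3 : (L k : ℝ) = i + 1 := by exact_mod_cast h2.symm
        rw [h3]
        ring
    simp_rw [hsplit]
    rw [Finset.sum_add_distrib, hup]
    -- From level 1 the jump down leads to `none`, outside the sum over the branch; this is where `H
    -- 0 = 0` is used.
    rcases Nat.eq_zero_or_pos (i : ℕ) with h0 | h0
    · simp [h0, hH]
    · obtain ⟨n, hn⟩ : ∃ n, (i : ℕ) = n + 1 := ⟨i - 1, by omega⟩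
      have hdown : ∑ m ∈ Finset.range (L k), (if (i : ℕ) = m + 1 then
          ((i : ℝ) + 1) * (H i - H (i + 1)) else 0) = ((i : ℝ) + 1) * (H i - H (i + 1)) := by
        rw [Finset.sum_eq_single n]
        · rw [if_pos hn]
        · intro m _ hm
          rw [if_neg (by omega)]
        · intro hm
          exact absurd (Finset.mem_range.2 (by omega)) hm
      rw [hdown, if_neg h0.ne']
      ring
  · intro j _ hj
    refine Finset.sum_eq_zero fun m _ => ?_
    simp [activityRate, hj.symm]
  · simp

theorem killedGenerator_mulVec_levelFunction_of_ne (H : ℕ → ℝ) {j : Fin K} (hj : j ≠ k)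
    (i : Fin (L j)) :
    (killedGenerator (activityGenerator L a) none).mulVec (levelFunction L k H)
      (some ⟨j, i⟩) = 0 := by
  rw [killedGenerator_generatorMatrix_mulVec none _ (show levelFunction L k H none = 0 from rfl)
    (by simp)]
  refine Finset.sum_eq_zero fun y _ => ?_
  match y with
  | none => simp [levelFunction, hj]
  | some ⟨j', i'⟩ =>
    by_cases h : j = j'
    · subst h
      simp [levelFunction, hj]
    · simp [activityRate, h]

/-- Pointwise comparison of the killed generator on functions of the level. -/
theorem killedGenerator_mulVec_levelFunction_le {H G : ℕ → ℝ} (hH : H 0 = 0)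
    (h : ∀ i < L k, (i + 1) * (H i - H (i + 1)) +
      (L k - (i + 1)) * a k * (H (i + 2) - H (i + 1)) ≤ G (i + 1)) (y : ActivityState L) :
    (killedGenerator (activityGenerator L a) none).mulVec (levelFunction L k H) y ≤
      levelFunction L k G y := by
  match y with
  | none => rw [killedGenerator_mulVec_self]; rfl
  | some ⟨j, i⟩ =>
    by_cases hj : j = k
    · subst hj
      rw [killedGenerator_mulVec_levelFunction hH]
      simpa [levelFunction] using h i i.isLt
    · rw [killedGenerator_mulVec_levelFunction_of_ne H hj]
      simp [levelFunction, hj]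

/-- The states outside branch `k` other than the bottleneck state. -/
def otherBranches (L : Fin K → ℕ) (k : Fin K) : Set (ActivityState L) :=
  {y | ∃ j i, j ≠ k ∧ y = some ⟨j, i⟩}

/-- The indicator is constant along jumps within a branch and can only drop on a jump to the
bottleneck, so it is superharmonic for the killed process. -/
theorem killedGenerator_mulVec_otherBranches_le (y : ActivityState L) :
    (killedGenerator (activityGenerator L a) none).mulVec
      ((otherBranches L k).indicator 1) y ≤ 0 := by
  match y with
  | none => rw [killedGenerator_mulVec_self]
  | some ⟨j, i⟩ =>
    rw [killedGenerator_generatorMatrix_mulVec none _ (by simp [otherBranches]) (by simp)]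
    refine Finset.sum_nonpos fun y _ => ?_
    match y with
    | none =>
      refine mul_nonpos_of_nonneg_of_nonpos ?_ ?_
      · simp only [activityRate]; split_ifs <;> norm_num
      · have : (0 : ℝ) ≤ (otherBranches L k).indicator 1 (some ⟨j, i⟩) :=
          Set.indicator_nonneg (fun _ _ => zero_le_one) _
        simpa [otherBranches] using this
    | some ⟨j', i'⟩ =>
      by_cases h : j = j'
      · subst h
        have : (otherBranches L k).indicator (1 : ActivityState L → ℝ) (some ⟨j, i'⟩) =
            (otherBranches L k).indicator (1 : ActivityState L → ℝ) (some ⟨j, i⟩) := by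
          simp [otherBranches, Set.indicator_apply]
        rw [this, sub_self, mul_zero]
      · simp [activityRate, h]

end Generator

/-! ### Escape from a branch for fixed activation rates -/

section Activity

variable {K : ℕ} {L : Fin K → ℕ} {a : Fin K → ℝ} {k : Fin K} {l : Fin (L k)} {Ω : Type*}
  [MeasurableSpace Ω] {P : Measure Ω} [IsProbabilityMeasure P] {X : ℝ≥0 → Ω → ActivityState L}

theorem IsMarkovProcess.integral_killedMean_mono
    (hX : IsMarkovProcess (activityGenerator L a) (some ⟨k, l⟩) P X) {h g : ActivityState L → ℝ}
    (hz : h none = 0) (gz : g none = 0) (hg : ∀ y, h y ≤ g y) {t : ℝ} (ht : 0 ≤ t) :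
    ∫ s in (0 : ℝ)..t, killedMean (activityGenerator L a) none (some ⟨k, l⟩) h s ≤
      ∫ s in (0 : ℝ)..t, killedMean (activityGenerator L a) none (some ⟨k, l⟩) g s :=
  intervalIntegral.integral_mono_on ht
    ((continuous_killedMean _ _ _ _).intervalIntegrable _ _)
    ((continuous_killedMean _ _ _ _).intervalIntegrable _ _)
    fun _ hs => hX.killedMean_mono (by simp) hz gz hg hs.1

/-- Before it visits the bottleneck state, the process does not leave its branch. -/
theorem IsMarkovProcess.killedMean_otherBranches
    (hX : IsMarkovProcess (activityGenerator L a) (some ⟨k, l⟩) P X)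
    {t : ℝ} (ht : 0 ≤ t) :
    killedMean (activityGenerator L a) none (some ⟨k, l⟩)
      ((otherBranches L k).indicator 1) t = 0 := by
  have h1 := killedMean_sub_eq_integral (activityGenerator L a) none (some ⟨k, l⟩)
    ((otherBranches L k).indicator 1) t
  have h2 := hX.integral_killedMean_mono (killedGenerator_mulVec_self none (activityGenerator L a)
    _)
    (g := 0) rfl (killedGenerator_mulVec_otherBranches_le (a := a) (k := k)) ht
  have h3 : (otherBranches L k).indicator (1 : ActivityState L → ℝ) (some ⟨k, l⟩) = 0 := by
    refine Set.indicator_of_notMem ?_ _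
    rintro ⟨j, i, hj, h⟩
    simp only [Option.some.injEq, Sigma.mk.injEq] at h
    exact hj h.1.symm
  have h4 : ∀ s, killedMean (activityGenerator L a) none (some ⟨k, l⟩) 0 s = 0 := fun s => by simp
    [killedMean]
  simp only [h4, intervalIntegral.integral_zero] at h2
  -- By Dynkin's formula the mean is at most its initial value `0`, and it is nonnegative.
  refine le_antisymm (by linarith) (hX.killedMean_nonneg (by simp) (by simp [otherBranches])
    (fun y => Set.indicator_nonneg (fun _ _ => zero_le_one) y) ht)

/-- The mean of a function of the state before hitting the bottleneck state is bounded by the mean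
of a function of the level in the initial branch. -/
theorem IsMarkovProcess.killedMean_le_levelFunction
    (hX : IsMarkovProcess (activityGenerator L a) (some ⟨k, l⟩) P X)
    {F : Set (ActivityState L)} (hF : none ∉ F) {G : ℕ → ℝ} (hG : ∀ m, 0 ≤ G m)
    (hFG : ∀ i : Fin (L k), some ⟨k, i⟩ ∈ F → 1 ≤ G (i + 1)) {t : ℝ} (ht : 0 ≤ t) :
    killedMean (activityGenerator L a) none (some ⟨k, l⟩) (F.indicator 1) t ≤
      killedMean (activityGenerator L a) none (some ⟨k, l⟩) (levelFunction L k G) t := by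
  have h1 := hX.killedMean_mono (z := none) (by simp) (h := F.indicator 1)
    (g := levelFunction L k G + (otherBranches L k).indicator 1) (by simp [hF])
    (by simp [levelFunction, otherBranches]) ?_ ht
  · rwa [killedMean_add, hX.killedMean_otherBranches ht, add_zero] at h1
  · intro y
    match y with
    | none => simp [levelFunction, otherBranches, hF]
    | some ⟨j, i⟩ =>
      by_cases hj : j = k
      · subst hj
        have h2 : (some ⟨j, i⟩ : ActivityState L) ∉ otherBranches L j := by
          rintro ⟨j', i', hj', h⟩
          simp only [Option.some.injEq, Sigma.mk.injEq] at h
          exact hj' h.1.symm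
        simp only [Pi.add_apply, Set.indicator_of_notMem h2, levelFunction, if_true, add_zero]
        by_cases h3 : (some ⟨j, i⟩ : ActivityState L) ∈ F
        · simpa [h3] using hFG i h3
        · simpa [h3] using hG _
      · have h2 : (some ⟨j, i⟩ : ActivityState L) ∈ otherBranches L k := ⟨j, i, hj, rfl⟩
        simp only [Pi.add_apply, Set.indicator_of_mem h2, levelFunction, if_neg hj, Pi.one_apply,
          zero_add]
        exact Set.indicator_apply_le' (fun _ => le_rfl) fun _ => zero_le_one

/-- This level function is the indicator of branch `k` alone, but the other branches carry no mass
before the escape, so it still measures survival. -/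
theorem IsMarkovProcess.killedMean_one
    (hX : IsMarkovProcess (activityGenerator L a) (some ⟨k, l⟩) P X)
    {t : ℝ} (ht : 0 ≤ t) :
    killedMean (activityGenerator L a) none (some ⟨k, l⟩)
      (levelFunction L k fun m => if m = 0 then 0 else 1) t =
      P.real (avoids X none t.toNNReal) := by
  have h1 := hX.killedMean_indicator_ne (z := none) (by simp) t.toNNReal
  rw [Real.coe_toNNReal t ht] at h1
  rw [← h1]
  refine le_antisymm (hX.killedMean_mono (by simp) rfl (by simp) ?_ ht)
    (hX.killedMean_le_levelFunction (by simp) (fun m => ?_) (fun i _ => by simp) ht)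
  · intro y
    match y with
    | none => simp [levelFunction]
    | some ⟨j, i⟩ =>
      simp only [levelFunction]
      split_ifs <;> simp
  · split_ifs <;> norm_num

/-- Dynkin's formula for the mean escape time. -/
theorem killedMean_escapeTime (a : Fin K → ℝ) (l : Fin (L k)) (t : ℝ) :
    escapeTime (L k) (a k) (l + 1) -
      killedMean (activityGenerator L a) none (some ⟨k, l⟩)
        (levelFunction L k (escapeTime (L k) (a k))) t =
    ∫ s in (0 : ℝ)..t, killedMean (activityGenerator L a) none (some ⟨k, l⟩)
      (levelFunction L k fun m => if m = 0 then 0 else 1) s := by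
  have h1 := killedMean_sub_eq_integral (activityGenerator L a) none (some ⟨k, l⟩)
    (levelFunction L k (escapeTime (L k) (a k))) t
  -- By the first-step equations, `escapeTime` solves the Poisson equation with right-hand side `-1`
  -- on the branch.
  have h2 : (killedGenerator (activityGenerator L a) none).mulVec
    (levelFunction L k (escapeTime (L k) (a k))) =
      (-1 : ℝ) • levelFunction L k fun m => if m = 0 then 0 else 1 := by
    ext y
    match y with
    | none => rw [killedGenerator_mulVec_self]; simp [levelFunction]
    | some ⟨j, i⟩ =>
      by_cases hj : j = k
      · subst hj
        rw [killedGenerator_mulVec_levelFunction (by simp [escapeTime]),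
          escapeTime_succ _ _ (i + 1), escapeTime_succ _ _ i]
        have h3 := mul_descentTime (a j) (Nat.succ_pos i) (Nat.succ_le_of_lt i.isLt)
        push_cast [Nat.succ_eq_add_one] at h3
        simp only [levelFunction, Pi.smul_apply, if_true, Nat.add_eq_zero_iff, one_ne_zero,
          and_false,
          if_false, smul_eq_mul, mul_one]
        linarith
      · rw [killedGenerator_mulVec_levelFunction_of_ne _ hj]
        simp [levelFunction, hj]
  rw [h2] at h1
  simp only [killedMean_smul, intervalIntegral.integral_const_mul] at h1
  have h3 : levelFunction L k (escapeTime (L k) (a k)) (some ⟨k, l⟩) =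
      escapeTime (L k) (a k) (l + 1) := by simp [levelFunction]
  rw [h3] at h1
  linarith

theorem IsMarkovProcess.meanHittingTime_le_escapeTime (ha : 0 ≤ a k)
    (hX : IsMarkovProcess (activityGenerator L a) (some ⟨k, l⟩) P X) :
    meanHittingTime P X none ≤ ENNReal.ofReal (escapeTime (L k) (a k) (l + 1)) := by
  have hpos : 0 < L k := l.pos
  refine hX.meanHittingTime_le (by simp) fun t ht => ?_
  have h1 : ∫ s in (0 : ℝ)..t, killedMean (activityGenerator L a) none (some ⟨k, l⟩)
      ((({none}ᶜ : Set (ActivityState L))).indicator 1) s =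
      ∫ s in (0 : ℝ)..t, killedMean (activityGenerator L a) none (some ⟨k, l⟩)
      (levelFunction L k fun m => if m = 0 then 0 else 1) s := by
    refine intervalIntegral.integral_congr fun s hs => ?_
    rw [Set.uIcc_of_le ht] at hs
    have h2 := hX.killedMean_indicator_ne (z := none) (by simp) s.toNNReal
    rw [Real.coe_toNNReal s hs.1] at h2
    simp only [hX.killedMean_one hs.1, h2]
  rw [h1, ← killedMean_escapeTime]
  have h3 : 0 ≤ killedMean (activityGenerator L a) none (some ⟨k, l⟩)
      (levelFunction L k (escapeTime (L k) (a k))) t := by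
    refine hX.killedMean_nonneg (by simp) rfl (fun y => ?_) ht
    match y with
    | none => exact le_rfl
    | some ⟨j, i⟩ =>
      simp only [levelFunction]
      split_ifs
      · exact (escapeTime_pos ha hpos (Nat.succ_pos _)).le
      · exact le_rfl
  linarith

theorem IsMarkovProcess.integral_killedMean_one_le
    (hX : IsMarkovProcess (activityGenerator L a) (some ⟨k, l⟩) P X)
    {t : ℝ} (ht : 0 ≤ t) :
    ∫ s in (0 : ℝ)..t, killedMean (activityGenerator L a) none (some ⟨k, l⟩)
      (levelFunction L k fun m => if m = 0 then 0 else 1) s ≤ t := by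
  calc _ ≤ ∫ s in (0 : ℝ)..t, (1 : ℝ) :=
        intervalIntegral.integral_mono_on ht
          ((continuous_killedMean _ _ _ _).intervalIntegrable _ _)
          (continuous_const.intervalIntegrable _ _)
          fun s hs => by
            rw [hX.killedMean_one hs.1]
            exact measureReal_le_one
    _ = t := by simp

/-- The escape time exceeds `t` with a probability of at least
`(E_l T - t) / E_L T`, where `L` is the top level. -/
theorem IsMarkovProcess.le_measureReal_avoids (ha : 0 ≤ a k)
    (hX : IsMarkovProcess (activityGenerator L a) (some ⟨k, l⟩) P X) {t : ℝ} (ht : 0 ≤ t) :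
    escapeTime (L k) (a k) (l + 1) - t ≤
      escapeTime (L k) (a k) (L k) * P.real (avoids X none t.toNNReal) := by
  have hpos : 0 < L k := l.pos
  have h1 := killedMean_escapeTime a l t
  have h2 := hX.integral_killedMean_one_le ht
  -- The mean remaining escape time at time `t` is at most that from the top level, on the event of
  -- survival.
  have h3 : killedMean (activityGenerator L a) none (some ⟨k, l⟩)
    (levelFunction L k (escapeTime (L k) (a k))) t ≤
      killedMean (activityGenerator L a) none (some ⟨k, l⟩) (escapeTime (L k) (a k) (L k) •
        levelFunction L k fun m => if m = 0 then 0 else 1) t := by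
    refine hX.killedMean_mono (by simp) rfl (by simp [levelFunction]) (fun y => ?_) ht
    match y with
    | none => simp [levelFunction]
    | some ⟨j, i⟩ =>
      by_cases hj : j = k
      · subst hj
        simpa [levelFunction] using escapeTime_mono ha hpos (Nat.succ_le_of_lt i.isLt)
      · simp [levelFunction, hj]
  rw [killedMean_smul, hX.killedMean_one ht] at h3
  linarith

/-- The bottleneck state is reached at rate at most one. -/
theorem IsMarkovProcess.one_sub_le_measureReal_avoids
    (hX : IsMarkovProcess (activityGenerator L a) (some ⟨k, l⟩) P X) {t : ℝ} (ht : 0 ≤ t) :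
    1 - t ≤ P.real (avoids X none t.toNNReal) := by
  have h1 := killedMean_sub_eq_integral (activityGenerator L a) none (some ⟨k, l⟩)
    (levelFunction L k fun m => if m = 0 then 0 else 1) t
  have h2 := hX.integral_killedMean_one_le ht
  have h3 := hX.integral_killedMean_mono (t := t)
    (h := (-1 : ℝ) • levelFunction L k fun m => if m = 0 then 0 else 1)
    (g := (killedGenerator (activityGenerator L a) none).mulVec
      (levelFunction L k fun m => if m = 0 then 0 else 1))
    (by simp [levelFunction]) (killedGenerator_mulVec_self _ _ _) (fun y => ?_) ht
  · simp only [killedMean_smul, intervalIntegral.integral_const_mul] at h3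
    rw [hX.killedMean_one ht] at h1
    have h4 : levelFunction L k (fun m => if m = 0 then 0 else 1) (some ⟨k, l⟩) = 1 := by
      simp [levelFunction]
    rw [h4] at h1
    linarith
  · match y with
    | none => rw [killedGenerator_mulVec_self]; simp [levelFunction]
    | some ⟨j, i⟩ =>
      by_cases hj : j = k
      · subst hj
        rw [killedGenerator_mulVec_levelFunction (by simp)]
        by_cases hi : (i : ℕ) = 0
        · simp [levelFunction, hi]
        · simp [levelFunction, hi]
      · rw [killedGenerator_mulVec_levelFunction_of_ne _ hj]
        simp [levelFunction, hj]

/-- Survival up to time `1 / 2` has probability at least `1 / 2`. The bound does not depend on the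
rates, so a time proportional to `E T` is long compared with `1 / a k`. -/
theorem IsMarkovProcess.quarter_le_meanHittingTime
    (hX : IsMarkovProcess (activityGenerator L a) (some ⟨k, l⟩) P X) :
    ENNReal.ofReal (1 / 4) ≤ meanHittingTime P X none := by
  have h1 := hX.one_sub_le_measureReal_avoids (t := 1 / 2) (by norm_num)
  have h2 : ENNReal.ofReal (1 / 2) ≤ P (avoids X none (1 / 2 : ℝ).toNNReal) := by
    refine ENNReal.ofReal_le_of_le_toReal ?_
    rw [← Measure.real]
    linarith
  have h3 := mul_meas_ge_le_lintegral (μ := P)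
    (measurable_hittingTimeOf hX.measurable hX.right_continuous none) (ENNReal.ofReal (1 / 2))
  calc ENNReal.ofReal (1 / 4) = ENNReal.ofReal (1 / 2) * ENNReal.ofReal (1 / 2) := by
        rw [← ENNReal.ofReal_mul (by norm_num)]; norm_num
    _ ≤ ENNReal.ofReal (1 / 2) * P (avoids X none (1 / 2 : ℝ).toNNReal) := by gcongr
    _ ≤ ENNReal.ofReal (1 / 2) * P {ω | ENNReal.ofReal (1 / 2) ≤ hittingTimeOf X none ω} := by
        gcongr
        intro ω hω
        exact ((lt_hittingTimeOf_iff hX.right_continuous none _ ω).2 hω).le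
    _ ≤ _ := h3

/-- The mean time that is spent away from full activity before the escape. -/
theorem IsMarkovProcess.lintegral_timeBefore_le (hL : ∀ j, 0 < L j) (ha : 0 < a k)
    (hX : IsMarkovProcess (activityGenerator L a) (some ⟨k, l⟩) P X) {t : ℝ} (ht : 0 ≤ t) :
    ∫⁻ ω, timeBefore X none {none, fullState L hL k}ᶜ t ω ∂P ≤
      ENNReal.ofReal ((L k - (l + 1)) / a k + L k / a k * t) := by
  -- A Lyapunov function: below the top, jumps up lower `H` by `1 / a k` at rate at least `a k`, a
  -- drift of at most `-1`; a jump down raises it by at most `1 / a k` at rate at most `L k`. The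
  -- value `0` at level `0` accounts for the killing.
  let H : ℕ → ℝ := fun m => if m = 0 then 0 else (L k - m) / a k
  let G : ℕ → ℝ := fun m => if m < L k then 1 else 0
  let B : ActivityState L → ℝ := levelFunction L k fun m => if m = 0 then 0 else 1
  rw [hX.lintegral_timeBefore (by simp) (by simp) ht]
  refine ENNReal.ofReal_le_ofReal ?_
  have h1 : ∫ s in (0 : ℝ)..t, killedMean (activityGenerator L a) none (some ⟨k, l⟩)
      (({none, fullState L hL k}ᶜ : Set (ActivityState L)).indicator 1) s ≤
      ∫ s in (0 : ℝ)..t, killedMean (activityGenerator L a) none (some ⟨k, l⟩)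
        (levelFunction L k G) s := by
    refine intervalIntegral.integral_mono_on ht
      ((continuous_killedMean _ _ _ _).intervalIntegrable _ _)
      ((continuous_killedMean _ _ _ _).intervalIntegrable _ _)
      fun s hs => hX.killedMean_le_levelFunction (by simp) (fun m => ?_) (fun i hi => ?_) hs.1
    · simp only [G]; split_ifs <;> norm_num
    · have h2 : (i : ℕ) + 1 < L k := by
        by_contra! h3
        have h4 := i.isLt
        refine hi (Or.inr ?_)
        simp only [fullState, Set.mem_singleton_iff, Option.some.injEq, Sigma.mk.injEq, heq_eq_eq,
          true_and]
        exact Fin.ext (by simp only; omega)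
      simp [G, h2]
  have h2 := killedMean_sub_eq_integral (activityGenerator L a) none (some ⟨k, l⟩)
    (levelFunction L k H) t
  have h3 := hX.integral_killedMean_mono (t := t)
    (h := (killedGenerator (activityGenerator L a) none).mulVec (levelFunction L k H))
    (g := (L k / a k : ℝ) • B - levelFunction L k G)
    (killedGenerator_mulVec_self _ _ _) (by simp [B, levelFunction]) (fun y => ?_) ht
  · have h4 : 0 ≤ killedMean (activityGenerator L a) none (some ⟨k, l⟩)
        (levelFunction L k H) t := by
      refine hX.killedMean_nonneg (by simp) rfl (fun y => ?_) ht
      match y with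
      | none => exact le_rfl
      | some ⟨j, i⟩ =>
        by_cases hj : j = k
        · subst hj
          have h5 : (i : ℝ) + 1 ≤ L j := by exact_mod_cast i.isLt
          simp only [levelFunction, if_true, H, Nat.add_eq_zero_iff, one_ne_zero, and_false,
            if_false]
          push_cast
          exact div_nonneg (by linarith) ha.le
        · simp [levelFunction, hj]
    have h5 : levelFunction L k H (some ⟨k, l⟩) = (L k - (l + 1)) / a k := by
      simp [levelFunction, H]
    have h6 := hX.integral_killedMean_one_le ht
    simp only [killedMean_sub, killedMean_smul] at h3
    rw [intervalIntegral.integral_sub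
      (((continuous_killedMean _ _ _ _).const_mul _).intervalIntegrable _ _)
      ((continuous_killedMean _ _ _ _).intervalIntegrable _ _),
      intervalIntegral.integral_const_mul] at h3
    have h7 : (L k : ℝ) / a k * ∫ s in (0 : ℝ)..t, killedMean (activityGenerator L a) none
      (some ⟨k, l⟩) B s ≤
        L k / a k * t := mul_le_mul_of_nonneg_left h6 (by positivity)
    rw [h5] at h2
    linarith
  · have h8 : ∀ i < L k, ((i : ℝ) + 1) * (H i - H (i + 1)) +
        (L k - (i + 1)) * a k * (H (i + 2) - H (i + 1)) ≤ L k / a k - G (i + 1) := by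
      intro i hi
      have hi' : (i : ℝ) + 1 ≤ L k := by exact_mod_cast hi
      have hup : (L k - (i + 1)) * a k * (H (i + 2) - H (i + 1)) = -(L k - (i + 1)) := by
        simp only [H, Nat.add_eq_zero_iff, one_ne_zero, and_false, if_false,
          OfNat.ofNat_ne_zero]
        push_cast
        field_simp
        ring
      have hdown : H i - H (i + 1) ≤ 1 / a k := by
        have h9 : H (i + 1) = (L k - (i + 1)) / a k := by simp [H]
        rw [h9]
        by_cases h0 : i = 0
        · subst h0
          simp only [H, if_true]
          rw [zero_sub, neg_le_iff_add_nonneg]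
          have h10 : (0 : ℝ) ≤ L k - 1 := by
            push_cast at hi'
            linarith
          push_cast
          have := div_nonneg h10 ha.le
          rw [zero_add]
          positivity
        · simp only [H, if_neg h0]
          rw [← sub_div]
          gcongr
          linarith
      have h11 : ((i : ℝ) + 1) * (H i - H (i + 1)) ≤ L k / a k := by
        calc _ ≤ ((i : ℝ) + 1) * (1 / a k) := by gcongr
          _ ≤ L k * (1 / a k) := by gcongr
          _ = _ := by ring
      have h12 : G (i + 1) ≤ L k - (i + 1) := by
        simp only [G]
        split_ifs with h
        · have : (i : ℝ) + 1 + 1 ≤ L k := by exact_mod_cast h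
          linarith
        · linarith
      linarith
    have h13 := killedGenerator_mulVec_levelFunction_le (H := H)
      (G := fun m => (L k / a k : ℝ) * (if m = 0 then 0 else 1) - G m) (by simp [H])
      (fun i hi => by simpa using h8 i hi) y
    refine h13.trans (le_of_eq ?_)
    match y with
    | none => simp [levelFunction, B]
    | some ⟨j, i⟩ => by_cases hj : j = k <;> simp [levelFunction, B, hj]

end Activity

/-! ### Probability bounds for early escape and for insufficient occupation. -/

section Estimates

variable {K : ℕ} {L : Fin K → ℕ} {a : Fin K → ℝ} {k : Fin K} {l : Fin (L k)} {Ω : Type*}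
  [MeasurableSpace Ω] {P : Measure Ω} [IsProbabilityMeasure P] {X : ℝ≥0 → Ω → ActivityState L}

theorem IsMarkovProcess.measure_avoids_occupationTime_lt_le (hL : ∀ j, 0 < L j) (ha : 0 < a k)
    (hX : IsMarkovProcess (activityGenerator L a) (some ⟨k, l⟩) P X) {t δ : ℝ}
    (ht : 0 ≤ t) (hδ : 0 < δ) :
    P {ω | ω ∈ avoids X none t.toNNReal ∧
        occupationTime X (fullState L hL k) t ω < (1 - δ) * t} ≤
      ENNReal.ofReal (((L k - (l + 1)) / (a k * t) + L k / a k) / δ) := by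
  -- At `t = 0` the event is empty.
  rcases ht.eq_or_lt with rfl | ht
  · simp [occupationTime]
  · refine (hX.measure_occupationTime_lt_le ht hδ
      (hX.lintegral_timeBefore_le hL ha ht.le)).trans (le_of_eq ?_)
    congr 1
    field_simp

theorem IsMarkovProcess.meanHittingTime_ne_top (ha : 0 ≤ a k)
    (hX : IsMarkovProcess (activityGenerator L a) (some ⟨k, l⟩) P X) :
    meanHittingTime P X none ≠ ∞ :=
  ne_top_of_le_ne_top ENNReal.ofReal_ne_top (hX.meanHittingTime_le_escapeTime ha)

theorem IsMarkovProcess.quarter_le_toReal_meanHittingTime (ha : 0 ≤ a k)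
    (hX : IsMarkovProcess (activityGenerator L a) (some ⟨k, l⟩) P X) :
    1 / 4 ≤ (meanHittingTime P X none).toReal :=
  (ENNReal.ofReal_le_iff_le_toReal (hX.meanHittingTime_ne_top ha)).1 hX.quarter_le_meanHittingTime

/-- The escape is unlikely to occur on a time scale much shorter than its mean. -/
theorem IsMarkovProcess.measure_compl_avoids_le (ha : (L k : ℝ) ≤ a k)
    (hX : IsMarkovProcess (activityGenerator L a) (some ⟨k, l⟩) P X) {t : ℝ}
    (ht : 0 ≤ t) :
    P (avoids X none t.toNNReal)ᶜ ≤
      ENNReal.ofReal ((L k : ℝ) ^ 2 / a k + t / (meanHittingTime P X none).toReal) := by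
  have hpos : 0 < L k := l.pos
  have hL0 : (0 : ℝ) < L k := by exact_mod_cast hpos
  have ha0 : 0 < a k := hL0.trans_le ha
  set e := (meanHittingTime P X none).toReal
  have he : 0 < e := lt_of_lt_of_le (by norm_num) (hX.quarter_le_toReal_meanHittingTime ha0.le)
  have h1 : e ≤ escapeTime (L k) (a k) (l + 1) :=
    ENNReal.toReal_le_of_le_ofReal (escapeTime_pos ha0.le hpos (Nat.succ_pos _)).le
      (hX.meanHittingTime_le_escapeTime ha0.le)
  have h2 := escapeTime_mono ha0.le hpos (Nat.succ_le_of_lt l.isLt)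
  have h3 := escapeTime_top_le hpos ha (Nat.succ_pos l)
  have h4 := hX.le_measureReal_avoids ha0.le ht
  rw [Nat.succ_eq_add_one] at h2 h3
  set p := P.real (avoids X none t.toNNReal)
  set u := escapeTime (L k) (a k) (l + 1)
  set v := escapeTime (L k) (a k) (L k)
  have hv : 0 < v := he.trans_le (h1.trans h2)
  have h5 : P.real (avoids X none t.toNNReal)ᶜ = 1 - p :=
    probReal_compl_eq_one_sub (measurableSet_avoids hX.measurable hX.right_continuous none _)
  rw [← ofReal_measureReal, h5]
  refine ENNReal.ofReal_le_ofReal ?_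
  -- `v * (1 - p) ≤ (v - u) + t` by `h4`; then `v - u ≤ (L k) ^ 2 / a k * u` by `h3`, and both `u`
  -- and `e` are at most `v`.
  have h6 : v * (1 - p) ≤ v * ((L k : ℝ) ^ 2 / a k + t / e) := by
    have h7 : t ≤ v * (t / e) := by
      rw [mul_div_assoc', le_div_iff₀ he, mul_comm v]
      gcongr
      exact h1.trans h2
    have h8 : (L k : ℝ) ^ 2 / a k * u ≤ (L k : ℝ) ^ 2 / a k * v := by gcongr
    linarith
  exact le_of_mul_le_mul_left h6 hv

end Estimates

theorem proposition7p1
    {K : ℕ} (L : Fin K → ℕ) (hL : ∀ j, 0 < L j)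
    -- activation rates of the components, as functions of the aggressiveness parameter
    (f : Fin K → ℝ≥0 → ℝ≥0) (hf_mono : ∀ j, Monotone (f j))
    (hf_lim : ∀ j, Tendsto (f j) atTop atTop)
    -- the initial state `(k, l + 1)` in branch `k`
    (k : Fin K) (l : Fin (L k))
    -- for each value of the aggressiveness parameter, the activity process
    {Ω : ℝ≥0 → Type*} [∀ ν, MeasurableSpace (Ω ν)]
    (P : ∀ ν, Measure (Ω ν)) [∀ ν, IsProbabilityMeasure (P ν)]
    (X : ∀ ν, ℝ≥0 → Ω ν → ActivityState L)
    (hX : ∀ ν, IsMarkovProcess (generatorMatrix (activityRate L fun j => (f j ν : ℝ)))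
      (some ⟨k, l⟩) (P ν) (X ν))
    -- the limit in distribution of the scaled escape time
    {Ω' : Type*} [MeasurableSpace Ω'] (P' : Measure Ω') [IsProbabilityMeasure P']
    (Z : Ω' → ℝ)
    (hZ : TendstoInDistribution
      (fun ν x => (hittingTimeOf (X ν) none x).toReal / (meanHittingTime (P ν) (X ν) none).toReal)
      atTop Z P P') :
    (∀ ν, meanHittingTime (P ν) (X ν) none ≠ ∞) ∧
    (∀ w ∈ Set.Icc (0 : ℝ) 1, ∀ δ : ℝ, 0 < δ →
      P' {x | w ≤ Z x} ≤
        liminf (fun ν => P ν {x |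
          (1 - δ) * (w * (meanHittingTime (P ν) (X ν) none).toReal) ≤
            occupationTime (X ν) (fullState L hL k)
              (w * (meanHittingTime (P ν) (X ν) none).toReal) x}) atTop) ∧
    (∀ t : ℝ≥0 → ℝ, (∀ ν, 0 ≤ t ν) →
      t =o[atTop] (fun ν => (meanHittingTime (P ν) (X ν) none).toReal) →
      (l : ℕ) + 1 = L k ∨ Tendsto (fun ν => (f k ν : ℝ) * t ν) atTop atTop →
      ∀ δ : ℝ, 0 < δ →
        liminf (fun ν => P ν {x |
          (1 - δ) * t ν ≤ occupationTime (X ν) (fullState L hL k) (t ν) x}) atTop = 1) := by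
  have he : ∀ ν, 1 / 4 ≤ (meanHittingTime (P ν) (X ν) none).toReal := fun ν =>
    (hX ν).quarter_le_toReal_meanHittingTime (f k ν).coe_nonneg
  have hf : Tendsto (fun ν => (f k ν : ℝ)) atTop atTop :=
    NNReal.tendsto_coe_atTop.2 (hf_lim k)
  have hbound : ∀ t : ℝ≥0 → ℝ, ((l : ℕ) + 1 = L k ∨
      Tendsto (fun ν => (f k ν : ℝ) * t ν) atTop atTop) → ∀ δ : ℝ,
      Tendsto (fun ν => ENNReal.ofReal
        (((L k - (l + 1)) / ((f k ν : ℝ) * t ν) + L k / (f k ν : ℝ)) / δ)) atTop (𝓝 0) := by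
    intro t ht δ
    rw [← ENNReal.ofReal_zero]
    refine ENNReal.tendsto_ofReal ?_
    have h1 : Tendsto (fun ν => ((L k : ℝ) - (l + 1)) / ((f k ν : ℝ) * t ν)) atTop (𝓝 0) := by
      rcases ht with h | h
      · have : (L k : ℝ) - (l + 1) = 0 := by
          rw [sub_eq_zero]
          exact_mod_cast h.symm
        simp [this]
      · exact h.const_div_atTop _
    simpa using (h1.add (hf.const_div_atTop (L k : ℝ))).div_const δ
  refine ⟨fun ν => (hX ν).meanHittingTime_ne_top (f k ν).coe_nonneg, ?_, ?_⟩
  · intro w hw δ hδ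
    -- When `w = 0` or `δ ≥ 1` the required occupation time is nonpositive.
    by_cases htriv : (1 - δ) * w ≤ 0
    · have huniv : ∀ ν, P ν {x | (1 - δ) * (w * (meanHittingTime (P ν) (X ν) none).toReal) ≤
            occupationTime (X ν) (fullState L hL k)
              (w * (meanHittingTime (P ν) (X ν) none).toReal) x} = 1 := by
        intro ν
        rw [← measure_univ (μ := P ν)]
        congr 1
        refine Set.eq_univ_of_forall fun x => ?_
        refine le_trans ?_ ((hX ν).occupationTime_nonneg _
          (mul_nonneg hw.1 ENNReal.toReal_nonneg) x)
        rw [← mul_assoc]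
        exact mul_nonpos_of_nonpos_of_nonneg htriv ENNReal.toReal_nonneg
      simp only [huniv, liminf_const]
      exact prob_le_one
    · have hw0 : 0 < w := by
        refine lt_of_le_of_ne hw.1 fun h => htriv ?_
        rw [← h, mul_zero]
      have hδ1 : δ < 1 := by
        by_contra! h
        exact htriv (mul_nonpos_of_nonpos_of_nonneg (by linarith) hw.1)
      -- The slack `δ` is shared: `w' < w` puts `{w ≤ Z}` inside the open event `{w' < Z}`, as the
      -- portmanteau theorem requires, and `(1 - δ / 2) ^ 2 ≥ 1 - δ` absorbs both losses.
      let w' : ℝ := (1 - δ / 2) * w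
      have hw' : 0 < w' := mul_pos (by linarith) hw0
      have hww : w' < w := by
        have : 0 < δ / 2 * w := by positivity
        simp only [w']
        linarith
      have hft : Tendsto (fun ν => (f k ν : ℝ) * (w' * (meanHittingTime (P ν) (X ν) none).toReal))
          atTop atTop := by
        refine tendsto_atTop_mono (fun ν => ?_) (hf.atTop_mul_const (show 0 < w' * (1 / 4) by
          positivity))
        gcongr
        exact he ν
      have hportmanteau := ProbabilityMeasure.le_liminf_measure_open_of_tendsto hZ.tendsto
        (isOpen_Ioi (a := w'))
      simp only [ProbabilityMeasure.coe_mk] at hportmanteau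
      rw [Measure.map_apply_of_aemeasurable hZ.aemeasurable_limit measurableSet_Ioi] at hportmanteau
      have h1 : P' {x | w ≤ Z x} ≤ P' (Z ⁻¹' Set.Ioi w') :=
        measure_mono fun x hx => hww.trans_le hx
      refine (h1.trans hportmanteau).trans ?_
      -- Adding an error that tends to zero does not change the lower limit, so it suffices to
      -- compare with the sum for large `ν`.
      refine le_trans ?_
        (ENNReal.liminf_add_of_right_tendsto_zero (hbound _ (Or.inr hft) (δ / 2)) _).le
      refine liminf_le_liminf ?_
      filter_upwards [hf.eventually_gt_atTop 0] with ν hν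
      rw [Measure.map_apply_of_aemeasurable (hZ.forall_aemeasurable ν) measurableSet_Ioi]
      have he0 : 0 < (meanHittingTime (P ν) (X ν) none).toReal := by linarith [he ν]
      set e := (meanHittingTime (P ν) (X ν) none).toReal
      have ht0 : 0 ≤ w' * e := by positivity
      refine le_trans ?_ (add_le_add_right
        ((hX ν).measure_avoids_occupationTime_lt_le hL hν ht0 (half_pos hδ)) _)
      refine (measure_mono ?_).trans (measure_union_le _ _)
      intro x hx
      have hx1 : w' * e < (hittingTimeOf (X ν) none x).toReal := (lt_div_iff₀ he0).1 hx
      have hx2 : x ∈ avoids (X ν) none (w' * e).toNNReal := by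
        refine (lt_hittingTimeOf_iff (hX ν).right_continuous none _ x).1 ?_
        -- `toReal` sends `∞` to `0`, so a scaled time above `w' > 0` is automatically finite.
        have hne : hittingTimeOf (X ν) none x ≠ ∞ := by
          intro h
          rw [h, ENNReal.toReal_top] at hx1
          linarith
        exact (ENNReal.ofReal_lt_iff_lt_toReal ht0 hne).2 hx1
      by_cases hocc : occupationTime (X ν) (fullState L hL k) (w' * e) x < (1 - δ / 2) * (w' * e)
      · exact Or.inr ⟨hx2, hocc⟩
      · left
        have hmono := (hX ν).occupationTime_mono (fullState L hL k) ht0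
          (mul_le_mul_of_nonneg_right hww.le he0.le) x
        have hsq : (1 - δ) * (w * e) ≤ (1 - δ / 2) * (w' * e) := by
          have : 0 ≤ (δ / 2) ^ 2 * (w * e) := by positivity
          simp only [w']
          linarith
        exact hsq.trans ((not_lt.1 hocc).trans hmono)
  · intro t ht hto hcase δ hδ
    refine le_antisymm ?_ ?_
    · calc _ ≤ liminf (fun _ : ℝ≥0 => (1 : ℝ≥0∞)) atTop :=
            liminf_le_liminf (Eventually.of_forall fun ν => prob_le_one)
        _ = 1 := liminf_const _
    · have h1 : Tendsto (fun ν => ENNReal.ofReal ((L k : ℝ) ^ 2 / (f k ν : ℝ) +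
          t ν / (meanHittingTime (P ν) (X ν) none).toReal)) atTop (𝓝 0) := by
        rw [← ENNReal.ofReal_zero]
        refine ENNReal.tendsto_ofReal ?_
        simpa using (hf.const_div_atTop ((L k : ℝ) ^ 2)).add hto.tendsto_div_nhds_zero
      have h2 := h1.add (hbound t hcase δ)
      rw [add_zero] at h2
      refine le_trans ?_ (ENNReal.liminf_add_of_right_tendsto_zero h2 _).le
      rw [← liminf_const (f := (atTop : Filter ℝ≥0)) (1 : ℝ≥0∞)]
      refine liminf_le_liminf ?_
      have hLk : (0 : ℝ) < L k := by exact_mod_cast hL k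
      filter_upwards [hf.eventually_ge_atTop (L k : ℝ)] with ν hν
      have hA := (hX ν).measure_compl_avoids_le hν (ht ν)
      have hB := (hX ν).measure_avoids_occupationTime_lt_le hL (hLk.trans_le hν) (ht ν) hδ
      refine le_trans ?_ (add_le_add_right (add_le_add hA hB) _)
      -- The whole space is covered by three events: enough occupation, escape by time `t ν`, and
      -- survival with too little occupation.
      rw [← measure_univ (μ := P ν)]
      refine (measure_mono ?_).trans ((measure_union_le _ _).trans
        (add_le_add_right (measure_union_le _ _) _))
      intro x _
      by_cases hocc : occupationTime (X ν) (fullState L hL k) (t ν) x < (1 - δ) * t ν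
      · by_cases hx : x ∈ avoids (X ν) none (t ν).toNNReal
        · exact Or.inr (Or.inr ⟨hx, hocc⟩)
        · exact Or.inr (Or.inl hx)
      · exact Or.inl (not_lt.1 hocc)
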